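/- \textbf{Random colored substitution networks.} Networks are finite directed networks whose arcs are colored by $1,\dots,\lambda$ (parallel arcs and loops are allowed). Let $G^0$ be such a network, and for each color $i$ let $R_{i1},\dots,R_{iq_i}$ be such networks, each with two distinct marked nodes $A$ and $B$, and let $p_{i1},\dots,p_{iq_i}\ge 0$ be probabilities with $\sum_k p_{ik}=1$. Given $G^{t}$, the network $G^{t+1}$ is obtained by replacing all arcs of $G^t$ simultaneously and independently: an $i$-colored arc $(x,y)$ is replaced with probability $p_{ik}$ by a fresh copy of $R_{ik}$, with $A$ identified with $x$ and $B$ with $y$. Thus $V(G^t)\subseteq V(G^{t+1})$. Let $V^*(G^0)=V(G^0)$ and $V^*(G^s)=V(G^s)\setminus V(G^{s-1})$ for $s\ge 1$. Write $\deg_j^+(G:v)$ and $\deg_j^-(G:v)$ for the numbers of $j$-colored arcs of $G$ that go out from $v$ and into $v$, respectively, and let $\deg_G(v)=\sum_j\bigl(\deg_j^+(G:v)+\deg_j^-(G:v)\bigr)$. Let $\mathbf N$ be the $2\lambda\times2\lambda$ matrix with $2\times 2$ blocks \[ \overline{\mathbf N}_{ij}=\sum_{k=1}^{q_i}p_{ik}\begin{pmatrix}\deg_j^+(R_{ik}:A)&\deg_j^-(R_{ik}:A)\\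 \deg_j^+(R_{ik}:B)&\deg_j^-(R_{ik}:B)\end{pmatrix}\qquad(1\le i,j\le\lambda), \] and let $\rho(\mathbf N)$ be its spectral radius. \textbf{Theorem.} Suppose that $\mathbf N$ is primitive (it is non-negative and some power $\mathbf N^m$, $m\ge1$, has only positive entries) and that neither $G^0$ nor any $R_{ik}$ has an isolated node (a node of degree $0$). Let $s\in\mathbb N=\{0,1,2,\dots\}$. (1) Almost surely, for every node $v\in V^*(G^s)$ there is a constant $c>0$ such that \[ \lim_{t\to\infty}\frac{\deg_{G^t}(v)}{\rho(\mathbf N)^{t-s}}=c . \] (2) Almost surely, for every node $v\in V^*(G^s)$ there is a constant $c>0$ such that, for all integers $t\ge s$, \[ c^{-1}\rho(\mathbf N)^{t-s}\le\deg_{G^t}(v)\le c\,\rho(\mathbf N)^{t-s}. \] -/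

import Mathlib

open Filter Topology MeasureTheory

noncomputable section

/-- A finite directed network whose arcs are coloured by `C`; its nodes are named by elements of `V`
and its arcs by elements of `E`, so parallel arcs and loops are possible. -/
structure Network (C V E : Type*) where
  nodes : Finset V
  arcs : Finset E
  src : E → V
  tgt : E → V
  color : E → C
  src_mem : ∀ e ∈ arcs, src e ∈ nodes
  tgt_mem : ∀ e ∈ arcs, tgt e ∈ nodes

namespace Network

variable {C V E : Type*}

open Classical in
/-- The number of `j`-coloured arcs of `G` going out from `v`. -/
def outDeg (G : Network C V E) (j : C) (v : V) : ℕ :=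
  (G.arcs.filter fun e => G.color e = j ∧ G.src e = v).card

open Classical in
/-- The number of `j`-coloured arcs of `G` going into `v`. -/
def inDeg (G : Network C V E) (j : C) (v : V) : ℕ :=
  (G.arcs.filter fun e => G.color e = j ∧ G.tgt e = v).card

open Classical in
/-- The degree of `v` in the undirected graph underlying `G` (a loop counts twice). -/
def deg (G : Network C V E) (v : V) : ℕ :=
  (G.arcs.filter fun e => G.src e = v).card + (G.arcs.filter fun e => G.tgt e = v).card

end Network

/-- The data of a random coloured substitution network with `l` colours: an initial network `init`
and, for each colour `i`, finitely many networks `rule i k`, each with two distinct marked nodes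
`A` and `B`, where `rule i k` is chosen with probability `p i k`. -/
structure SubstSystem (l : ℕ) (V₀ E₀ V E : Type*) where
  init : Network (Fin l) V₀ E₀
  q : Fin l → ℕ
  rule : (i : Fin l) → Fin (q i) → Network (Fin l) V E
  A : V
  B : V
  A_ne_B : A ≠ B
  A_mem : ∀ i k, A ∈ (rule i k).nodes
  B_mem : ∀ i k, B ∈ (rule i k).nodes
  p : (i : Fin l) → PMF (Fin (q i))

namespace SubstSystem

variable {l : ℕ} {V₀ E₀ V E : Type*}

/-- Names of all arcs that can ever arise: an arc of the initial network, or the arc `r` of the copy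
of `rule i k` that has replaced the arc `a`. -/
inductive Arc (S : SubstSystem l V₀ E₀ V E)
  | init (e : E₀) : Arc S
  | sub (a : Arc S) (i : Fin l) (k : Fin (S.q i)) (r : E) : Arc S

/-- Names of all nodes that can ever arise: a node of the initial network, or the node `w` of the
copy of `rule i k` that has replaced the arc `a`. -/
inductive Node (S : SubstSystem l V₀ E₀ V E)
  | init (v : V₀) : Node S
  | new (a : Arc S) (i : Fin l) (k : Fin (S.q i)) (w : V) : Node S

variable (S : SubstSystem l V₀ E₀ V E)

/-- The colour of an arc. -/
def color : Arc S → Fin l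
  | .init e => S.init.color e
  | .sub _ i k r => (S.rule i k).color r

open Classical in
/-- The position of the node `w` of the copy of `rule i k` replacing an arc `a` from `x` to `y`:
`A` is identified with `x`, `B` with `y`, and every other node is new. -/
def place (a : Arc S) (x y : Node S) (i : Fin l) (k : Fin (S.q i)) (w : V) : Node S :=
  if w = S.A then x else if w = S.B then y else .new a i k w

/-- The beginning node and the ending node of an arc. -/
def ends : Arc S → Node S × Node S
  | .init e => (.init (S.init.src e), .init (S.init.tgt e))
  | .sub a i k r =>
    (S.place a (ends a).1 (ends a).2 i k ((S.rule i k).src r),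
     S.place a (ends a).1 (ends a).2 i k ((S.rule i k).tgt r))

/-- A realisation of the random choices: for each arc `a`, the index of the network that replaces
`a`, should `a` arise. A realisation determines the whole sequence `G⁰, G¹, G², …`. -/
abbrev Realisation : Type _ := (a : Arc S) → Fin (S.q (S.color a))

/-- The law of the random choices: they are independent, and an arc of colour `i` is replaced by
`rule i k` with probability `p i k`. -/
def law : Measure S.Realisation :=
  Measure.infinitePi fun a : Arc S => (S.p (S.color a)).toMeasure

open Classical in
/-- The arcs of `Gᵗ`: in each step every arc is replaced by the arcs of the chosen network. -/
def arcs (ω : S.Realisation) : ℕ → Finset (Arc S)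
  | 0 => S.init.arcs.image .init
  | t + 1 => (arcs ω t).biUnion fun a =>
      (S.rule (S.color a) (ω a)).arcs.image (.sub a (S.color a) (ω a))

open Classical in
/-- The nodes of `Gᵗ`: in each step all nodes are kept, and each arc adds the nodes other than `A`
and `B` of the chosen network. -/
def nodes (ω : S.Realisation) : ℕ → Finset (Node S)
  | 0 => S.init.nodes.image .init
  | t + 1 => nodes ω t ∪ (arcs S ω t).biUnion fun a =>
      ((S.rule (S.color a) (ω a)).nodes \ {S.A, S.B}).image (.new a (S.color a) (ω a))

theorem ends_mem (ω : S.Realisation) (t : ℕ) :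
    ∀ a ∈ S.arcs ω t, (S.ends a).1 ∈ S.nodes ω t ∧ (S.ends a).2 ∈ S.nodes ω t := by
  classical
  induction t with
  | zero =>
    intro a ha
    simp only [arcs, Finset.mem_image] at ha
    obtain ⟨e, he, rfl⟩ := ha
    simp only [nodes, ends]
    exact ⟨Finset.mem_image_of_mem _ (S.init.src_mem e he),
      Finset.mem_image_of_mem _ (S.init.tgt_mem e he)⟩
  | succ t ih =>
    intro b hb
    simp only [arcs, Finset.mem_biUnion, Finset.mem_image] at hb
    obtain ⟨a, ha, r, hr, rfl⟩ := hb
    have key : ∀ w ∈ (S.rule (S.color a) (ω a)).nodes,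
        S.place a (S.ends a).1 (S.ends a).2 (S.color a) (ω a) w ∈ S.nodes ω (t + 1) := by
      intro w hw
      unfold place
      simp only [nodes, Finset.mem_union]
      split_ifs with h1 h2
      · exact Or.inl (ih a ha).1
      · exact Or.inl (ih a ha).2
      · refine Or.inr (Finset.mem_biUnion.2 ⟨a, ha, Finset.mem_image_of_mem _ ?_⟩)
        simp [hw, h1, h2]
    exact ⟨key _ ((S.rule _ _).src_mem r hr), key _ ((S.rule _ _).tgt_mem r hr)⟩

/-- The network `Gᵗ` of a realisation. -/
def graph (ω : S.Realisation) (t : ℕ) : Network (Fin l) (Node S) (Arc S) where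
  nodes := S.nodes ω t
  arcs := S.arcs ω t
  src a := (S.ends a).1
  tgt a := (S.ends a).2
  color := S.color
  src_mem a ha := (S.ends_mem ω t a ha).1
  tgt_mem a ha := (S.ends_mem ω t a ha).2

open Classical in
/-- The nodes created at step `s`: those of `G⁰` if `s = 0`, and those of `Gˢ` that are not nodes of
`Gˢ⁻¹` otherwise. -/
def newNodes (ω : S.Realisation) : ℕ → Finset (Node S)
  | 0 => (S.graph ω 0).nodes
  | s + 1 => (S.graph ω (s + 1)).nodes \ (S.graph ω s).nodes

/-- The `2l × 2l` mean degree matrix `N`. The row `(i, 0)` belongs to the node `A` and the row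
`(i, 1)` to the node `B` of the networks replacing `i`-coloured arcs; the column `(j, 0)` counts
out-going and the column `(j, 1)` in-going `j`-coloured arcs. -/
def meanDegMatrix : Matrix (Fin l × Fin 2) (Fin l × Fin 2) ℝ := fun x y =>
  ∑ k : Fin (S.q x.1), (S.p x.1 k).toReal *
    ((if y.2 = 0 then (S.rule x.1 k).outDeg y.1 (if x.2 = 0 then S.A else S.B)
      else (S.rule x.1 k).inDeg y.1 (if x.2 = 0 then S.A else S.B) : ℕ) : ℝ)

end SubstSystem

/-- The spectral radius of a real square matrix: the largest modulus of a complex eigenvalue. -/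
def specRadius {n : Type*} [Fintype n] [DecidableEq n] (X : Matrix n n ℝ) : ℝ :=
  (spectralRadius ℂ (X.map (algebraMap ℝ ℂ))).toReal

/-- `f t / g t` converges to a positive constant as `t → ∞`. -/
def AsympEquivUpToConst (f g : ℕ → ℝ) : Prop :=
  ∃ c : ℝ, 0 < c ∧ Tendsto (fun t => f t / g t) atTop (𝓝 c)

end

/-! ### Perron–Frobenius theory of primitive matrices -/

noncomputable section Perron

open scoped Matrix

variable {n : Type*} [Fintype n] [DecidableEq n]

/-! Fix a node v that can exist at step s and follow the vector x_t of its coloured out- and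
in-degrees at step s + t. Each arc end at v is replaced by the arc ends at A or B of a random rule,
so the conditional mean of x_{t+1} is x_t N. A loop at v makes its two ends dependent, so this is
not quite a branching process; but the error x_{t+1} - x_t N, tested against a vector, is a sum of
centred functions of the choices at distinct arcs, and its conditional variance is at most a
constant times the degree of v.

Let r > 0 be a Perron eigenvector and ρ its eigenvalue. As A and B are never isolated, degrees never
decrease and the row sums of N are at least 1, whence ρ ≥ 1. If ρ = 1, then r is constant, so the
degree has constant mean and, being non-decreasing, is almost surely constant. If ρ > 1, put Z_t =
x_t · r. The martingale Z_t / ρ^t moves by steps of mean size O(ρ^(-t/2)) and so converges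
(`IsMeanGrowth.ae_summable`). Its limit is almost surely non-zero if v is present
(`IsMeanGrowth.ae_not_tendsto_zero`): restarted at time t, a path to 0 needs relative errors of sum
at least 1, and the probability of this is controlled by E[1/Z_t], which tends to 0 because the
degree does not stay bounded. Since N^k 1 / ρ^k tends to a positive multiple of r, convergence of
Z_t / ρ^t gives that of the degree (`tendsto_dotProduct_div_pow`).

Every G^t depends on finitely many choices with finitely many values, so measurability and
integrability come for free; and only finitely many nodes can exist at step s, so the exceptional
null sets can be united. Part (2) follows from part (1) and the positivity of degrees. -/

theorem Matrix.row_sum_pow_eq_one {Q : Matrix n n ℝ} (hs : ∀ i, ∑ j, Q i j = 1) (k : ℕ) (i : n) :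
    ∑ j, (Q ^ k) i j = 1 := by
  induction k generalizing i with
  | zero => simp [Matrix.one_apply]
  | succ k ih =>
    simp only [pow_succ, Matrix.mul_apply]
    rw [Finset.sum_comm]
    simp [← Finset.mul_sum, hs, ih]

/-- The powers of a primitive stochastic matrix send every vector to a constant in the limit. -/
theorem Matrix.exists_tendsto_pow_mulVec_of_stochastic [Nonempty n] {Q : Matrix n n ℝ}
    (hQ : Q.IsPrimitive) (hs : ∀ i, ∑ j, Q i j = 1) (f : n → ℝ) :
    ∃ β : ℝ, (∃ i, f i ≤ β) ∧ ∀ i, Tendsto (fun k => ((Q ^ k) *ᵥ f) i) atTop (𝓝 β) := by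
  obtain ⟨hnn, m, hm, hpos⟩ := hQ
  set u : ℕ → n → ℝ := fun k => (Q ^ k) *ᵥ f with hu
  have bddA : ∀ k, BddAbove (Set.range (u k)) := fun k => (Set.finite_range _).bddAbove
  have bddB : ∀ k, BddBelow (Set.range (u k)) := fun k => (Set.finite_range _).bddBelow
  have hadd : ∀ k d i, u (k + d) i = ∑ j, (Q ^ d) i j * u k j := by
    intro k d i
    simp only [hu]
    rw [add_comm k d, pow_add, ← Matrix.mulVec_mulVec]
    rfl
  have hpn : ∀ d i j, 0 ≤ (Q ^ d) i j := fun d i j => Matrix.pow_apply_nonneg hnn d i j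
  have hup : ∀ k d i, u (k + d) i ≤ ⨆ j, u k j := by
    intro k d i
    rw [hadd]
    calc ∑ j, (Q ^ d) i j * u k j ≤ ∑ j, (Q ^ d) i j * ⨆ j, u k j :=
          Finset.sum_le_sum fun j _ => mul_le_mul_of_nonneg_left (le_ciSup (bddA k) j) (hpn d i j)
      _ = _ := by rw [← Finset.sum_mul, row_sum_pow_eq_one hs, one_mul]
  have hlo : ∀ k d i, ⨅ j, u k j ≤ u (k + d) i := by
    intro k d i
    rw [hadd]
    calc ⨅ j, u k j = ∑ j, (Q ^ d) i j * ⨅ j, u k j := by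
          rw [← Finset.sum_mul, row_sum_pow_eq_one hs, one_mul]
      _ ≤ _ := Finset.sum_le_sum fun j _ =>
          mul_le_mul_of_nonneg_left (ciInf_le (bddB k) j) (hpn d i j)
  have hle : ∀ k, ⨅ j, u k j ≤ ⨆ j, u k j := fun k =>
    (ciInf_le (bddB k) (Classical.arbitrary n)).trans (le_ciSup (bddA k) _)
  have hanti : Antitone fun k => ⨆ j, u k j :=
    antitone_nat_of_succ_le fun k => ciSup_le fun i => hup k 1 i
  have hmono : Monotone fun k => ⨅ j, u k j :=
    monotone_nat_of_le_succ fun k => le_ciInf fun i => hlo k 1 i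
  have hlim1 : Tendsto (fun k => ⨆ j, u k j) atTop (𝓝 (⨅ k, ⨆ j, u k j)) :=
    tendsto_atTop_ciInf hanti ⟨⨅ j, u 0 j, by
      rintro _ ⟨k, rfl⟩; exact (hmono (Nat.zero_le k)).trans (hle k)⟩
  have hlim2 : Tendsto (fun k => ⨅ j, u k j) atTop (𝓝 (⨆ k, ⨅ j, u k j)) :=
    tendsto_atTop_ciSup hmono ⟨⨆ j, u 0 j, by
      rintro _ ⟨k, rfl⟩; exact (hle k).trans (hanti (Nat.zero_le k))⟩
  obtain ⟨⟨i₀, j₀⟩, hmin⟩ := Finite.exists_min fun x : n × n => (Q ^ m) x.1 x.2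
  set δ := (Q ^ m) i₀ j₀ with hδ
  have hδ0 : 0 < δ := hpos _ _
  -- Every row of Q ^ m gives weight at least δ to the coordinate where u k is smallest, so m steps
  -- lower the maximum by at least δ times the oscillation.
  have hstep : ∀ k, ⨆ j, u (k + m) j ≤ (⨆ j, u k j) - δ * ((⨆ j, u k j) - ⨅ j, u k j) := by
    intro k
    refine ciSup_le fun i => ?_
    obtain ⟨j₁, hj₁⟩ := Finite.exists_min (u k)
    have hI : u k j₁ ≤ ⨅ j, u k j := le_ciInf hj₁
    have h1 : ∑ j, (Q ^ m) i j * ((⨆ j, u k j) - u k j) = (⨆ j, u k j) - u (k + m) i := by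
      simp only [mul_sub, Finset.sum_sub_distrib]
      rw [← Finset.sum_mul, row_sum_pow_eq_one hs, one_mul, hadd]
    have hterm : ∀ j, 0 ≤ (Q ^ m) i j * ((⨆ j, u k j) - u k j) := fun j =>
      mul_nonneg (hpn _ _ _) (sub_nonneg.2 (le_ciSup (bddA k) j))
    have h2 := Finset.single_le_sum (f := fun j => (Q ^ m) i j * ((⨆ j, u k j) - u k j))
      (fun j _ => hterm j) (Finset.mem_univ j₁)
    have h3 : δ * ((⨆ j, u k j) - ⨅ j, u k j) ≤ (Q ^ m) i j₁ * ((⨆ j, u k j) - u k j₁) :=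
      mul_le_mul (hmin (i, j₁)) (by linarith) (sub_nonneg.2 (hle k)) (hpn _ _ _)
    linarith
  have hlim3 := hlim1.comp (tendsto_add_atTop_nat m)
  have hD := le_of_tendsto_of_tendsto' hlim3
    (hlim1.sub ((hlim1.sub hlim2).const_mul δ)) hstep
  have hge := le_of_tendsto_of_tendsto' hlim2 hlim1 hle
  -- In the limit of `hstep` the maximum no longer drops, so the limiting oscillation is zero.
  have heq : (⨅ k, ⨆ j, u k j) = ⨆ k, ⨅ j, u k j := by
    have : δ * ((⨅ k, ⨆ j, u k j) - ⨆ k, ⨅ j, u k j) ≤ 0 := by linarith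
    have := nonpos_of_mul_nonpos_right this hδ0
    linarith
  refine ⟨⨆ k, ⨅ j, u k j, ?_, fun i => ?_⟩
  · obtain ⟨j₁, hj₁⟩ := Finite.exists_min f
    refine ⟨j₁, ?_⟩
    have h0 := hmono.ge_of_tendsto hlim2 0
    refine le_trans (le_ciInf fun j => ?_) h0
    simpa [hu] using hj₁ j
  · rw [heq] at hlim1
    exact tendsto_of_tendsto_of_tendsto_of_le_of_le hlim2 hlim1
      (fun k => hlo k 0 i) (fun k => hup k 0 i)

theorem Matrix.pow_mulVec_of_eigen {N : Matrix n n ℝ} {ρ : ℝ} {r : n → ℝ}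
    (h : N *ᵥ r = ρ • r) (k : ℕ) : (N ^ k) *ᵥ r = ρ ^ k • r := by
  induction k with
  | zero => simp
  | succ k ih => rw [pow_succ, ← Matrix.mulVec_mulVec, h, Matrix.mulVec_smul, ih, smul_smul,
      pow_succ']

theorem Matrix.mulVec_pos_of_pos {ι : Type*} [Fintype ι] {P : Matrix ι ι ℝ} (hP : ∀ i j, 0 < P i j) {x : ι → ℝ}
    (hx : 0 ≤ x) (hx0 : x ≠ 0) (i : ι) : 0 < (P *ᵥ x) i := by
  obtain ⟨j, hj⟩ := Function.ne_iff.1 hx0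
  exact Finset.sum_pos' (fun j _ => mul_nonneg (hP i j).le (hx j))
    ⟨j, Finset.mem_univ j, mul_pos (hP i j) (lt_of_le_of_ne (hx j) (Ne.symm hj))⟩

/-- A primitive matrix has a positive eigenvector for a positive eigenvalue. -/
theorem Matrix.IsPrimitive.exists_pos_eigenvector [Nonempty n] {N : Matrix n n ℝ}
    (hN : N.IsPrimitive) :
    ∃ (ρ : ℝ) (r : n → ℝ), 0 < ρ ∧ (∀ i, 0 < r i) ∧ N *ᵥ r = ρ • r := by
  obtain ⟨hnn, m, hm, hpos⟩ := hN
  set B := ∑ i, ∑ j, N i j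
  have hbound : ∀ (α : ℝ) (x : n → ℝ), x ∈ stdSimplex ℝ n → (∀ i, α * x i ≤ (N *ᵥ x) i) →
      α ≤ B := by
    intro α x hx h
    have hx1 : ∀ j, x j ≤ 1 := fun j => (mem_Icc_of_mem_stdSimplex hx j).2
    calc α = ∑ i, α * x i := by rw [← Finset.mul_sum, hx.2, mul_one]
      _ ≤ ∑ i, (N *ᵥ x) i := Finset.sum_le_sum fun i _ => h i
      _ ≤ B := Finset.sum_le_sum fun i _ => Finset.sum_le_sum fun j _ =>
          mul_le_of_le_one_right (hnn i j) (hx1 j)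
  -- Collatz–Wielandt: the Perron root is the largest α admitting x in the simplex with α x ≤ N x.
  -- The bound B makes the set of such pairs compact.
  let K : Set (ℝ × (n → ℝ)) :=
    (Set.Icc 0 B ×ˢ stdSimplex ℝ n) ∩ {q | ∀ i, q.1 * q.2 i ≤ (N *ᵥ q.2) i}
  have hK : IsCompact K := by
    refine (isCompact_Icc.prod (isCompact_stdSimplex ℝ n)).inter_right ?_
    have : {q : ℝ × (n → ℝ) | ∀ i, q.1 * q.2 i ≤ (N *ᵥ q.2) i} =
        ⋂ i, {q | q.1 * q.2 i ≤ (N *ᵥ q.2) i} := by ext; simp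
    rw [this]
    refine isClosed_iInter fun i => isClosed_le (by fun_prop) ?_
    simp only [Matrix.mulVec, dotProduct]
    fun_prop
  have hKne : K.Nonempty := by
    obtain ⟨i₀⟩ := (inferInstance : Nonempty n)
    refine ⟨(0, Pi.single i₀ 1), ⟨⟨⟨le_rfl, ?_⟩, single_mem_stdSimplex ℝ i₀⟩, fun i => ?_⟩⟩
    · exact Finset.sum_nonneg fun i _ => Finset.sum_nonneg fun j _ => hnn i j
    · simp [hnn]
  obtain ⟨⟨α, x⟩, ⟨⟨⟨hα0, -⟩, hx⟩, hαx⟩, hmax⟩ := hK.exists_isMaxOn hKne continuous_fst.continuousOn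
  simp only [Set.mem_ofPred_eq] at hαx hα0 hx
  have hx0 : x ≠ 0 := by
    rintro rfl
    have := hx.2
    simp at this
  have hy : ∀ i, 0 < ((N ^ m) *ᵥ x) i := mulVec_pos_of_pos hpos hx.1 hx0
  have heig : N *ᵥ x = α • x := by
    -- If α x ≤ N x is not an equality, applying N ^ m makes the slack strictly positive everywhere;
    -- then N ^ m x, normalised, admits α + ε, against maximality.
    by_contra hne
    set z := N *ᵥ x - α • x with hz
    have hz0 : 0 ≤ z := fun i => by simpa [hz] using hαx i
    have hzne : z ≠ 0 := sub_ne_zero.2 hne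
    set y := (N ^ m) *ᵥ x with hydef
    have hNz : (N ^ m) *ᵥ z = N *ᵥ y - α • y := by
      rw [hz, Matrix.mulVec_sub, Matrix.mulVec_smul, hydef, Matrix.mulVec_mulVec,
        Matrix.mulVec_mulVec, ← pow_succ, ← pow_succ']
    have hzpos : ∀ i, 0 < (N *ᵥ y - α • y) i := hNz ▸ mulVec_pos_of_pos hpos hz0 hzne
    obtain ⟨i₀, hi₀⟩ := Finite.exists_min fun i => (N *ᵥ y - α • y) i / y i
    set ε := (N *ᵥ y - α • y) i₀ / y i₀
    have hε : 0 < ε := div_pos (hzpos _) (hy _)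
    have hyε : ∀ i, (α + ε) * y i ≤ (N *ᵥ y) i := by
      intro i
      have := (le_div_iff₀ (hy i)).1 (hi₀ i)
      simp only [Pi.sub_apply, Pi.smul_apply, smul_eq_mul] at this
      linarith
    set σ := ∑ i, y i
    have hσ : 0 < σ := Finset.sum_pos (fun i _ => hy i) Finset.univ_nonempty
    have hmem : σ⁻¹ • y ∈ stdSimplex ℝ n := by
      refine ⟨fun i => ?_, ?_⟩
      · exact mul_nonneg (inv_nonneg.2 hσ.le) (hy i).le
      · simp only [Pi.smul_apply, smul_eq_mul, ← Finset.mul_sum]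
        exact inv_mul_cancel₀ hσ.ne'
    have hineq : ∀ i, (α + ε) * (σ⁻¹ • y) i ≤ (N *ᵥ (σ⁻¹ • y)) i := by
      intro i
      rw [Matrix.mulVec_smul]
      simp only [Pi.smul_apply, smul_eq_mul]
      have := mul_le_mul_of_nonneg_left (hyε i) (inv_nonneg.2 hσ.le)
      linarith
    have := hmax (a := (α + ε, σ⁻¹ • y))
      ⟨⟨⟨by linarith, hbound _ _ hmem hineq⟩, hmem⟩, hineq⟩
    simp at this
    linarith
  -- The vector α ^ m x = N ^ m x is positive, which forces both α > 0 and x > 0.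
  have hpow := pow_mulVec_of_eigen heig m
  have hpr : ∀ i, 0 < α ^ m * x i := fun i => by simpa [hpow] using hy i
  refine ⟨α, x, ?_, fun i => ?_, heig⟩
  · refine lt_of_le_of_ne hα0 fun h => ?_
    have := hpr (Classical.arbitrary n)
    rw [← h, zero_pow hm.ne'] at this
    simp at this
  · exact pos_of_mul_pos_right (hpr i) (pow_nonneg hα0 m)

/-- The spectral radius of a non-negative matrix is the eigenvalue of any positive eigenvector. -/
theorem specRadius_eq_of_pos_eigenvector [Nonempty n] {N : Matrix n n ℝ}
    (hN : ∀ i j, 0 ≤ N i j) {ρ : ℝ} (hρ : 0 < ρ) {r : n → ℝ} (hr : ∀ i, 0 < r i)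
    (h : N *ᵥ r = ρ • r) : specRadius N = ρ := by
  set M := N.map (algebraMap ℝ ℂ)
  have hspec : ∀ k : ℂ, k ∈ spectrum ℂ M ↔ ∃ z : n → ℂ, z ≠ 0 ∧ M *ᵥ z = k • z := by
    intro k
    rw [← Matrix.spectrum_toLin', ← Module.End.hasEigenvalue_iff_mem_spectrum]
    constructor
    · intro hk
      obtain ⟨z, hz⟩ := hk.exists_hasEigenvector
      exact ⟨z, hz.2, by simpa using hz.apply_eq_smul⟩
    · rintro ⟨z, hz0, hz⟩
      exact Module.End.hasEigenvalue_of_hasEigenvector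
        ⟨Module.End.mem_eigenspace_iff.2 (by simpa using hz), hz0⟩
  have key : spectralRadius ℂ M = ENNReal.ofReal ρ := by
    apply le_antisymm
    · refine iSup₂_le fun k hk => ?_
      obtain ⟨z, hz0, hz⟩ := (hspec k).1 hk
      -- Where |z| / r is largest, |z| touches the multiple c r from below, so row i₀ of the
      -- eigenvalue equation yields |k| ≤ ρ.
      obtain ⟨i₀, hi₀⟩ := Finite.exists_max fun i => ‖z i‖ / r i
      set c := ‖z i₀‖ / r i₀ with hc
      have hzc : ∀ i, ‖z i‖ ≤ c * r i := fun i => (div_le_iff₀ (hr i)).1 (hi₀ i)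
      have hc0 : 0 < ‖z i₀‖ := by
        obtain ⟨j, hj⟩ := Function.ne_iff.1 hz0
        have h1 : 0 < ‖z j‖ := norm_pos_iff.2 hj
        have h2 : 0 < c := pos_of_mul_pos_left (h1.trans_le (hzc j)) (hr j).le
        rw [hc] at h2
        exact (div_pos_iff_of_pos_right (hr i₀)).1 h2
      have h1 : ‖k‖ * ‖z i₀‖ ≤ ρ * ‖z i₀‖ := by
        calc ‖k‖ * ‖z i₀‖ = ‖(M *ᵥ z) i₀‖ := by rw [hz]; simp
          _ ≤ ∑ j, N i₀ j * ‖z j‖ := by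
            refine (norm_sum_le _ _).trans (Finset.sum_le_sum fun j _ => ?_)
            rw [norm_mul]
            simp [M, abs_of_nonneg (hN i₀ j)]
          _ ≤ ∑ j, N i₀ j * (c * r j) :=
            Finset.sum_le_sum fun j _ => mul_le_mul_of_nonneg_left (hzc j) (hN _ _)
          _ = c * (N *ᵥ r) i₀ := by
            simp only [Matrix.mulVec, dotProduct, Finset.mul_sum]
            exact Finset.sum_congr rfl fun j _ => by ring
          _ = ρ * ‖z i₀‖ := by
            rw [h, hc]
            have := (hr i₀).ne'
            simp only [Pi.smul_apply, smul_eq_mul]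
            field_simp
      have h2 : ‖k‖ ≤ ρ := le_of_mul_le_mul_right h1 hc0
      refine (ofReal_norm k).symm.le.trans ?_
      exact ENNReal.ofReal_le_ofReal h2
    · have hmem : (ρ : ℂ) ∈ spectrum ℂ M := by
        refine (hspec _).2 ⟨fun i => (r i : ℂ), ?_, ?_⟩
        · intro h0
          have := congrFun h0 (Classical.arbitrary n)
          simp [(hr _).ne'] at this
        · ext i
          have := congrFun h i
          simp only [Matrix.mulVec, dotProduct, Pi.smul_apply, smul_eq_mul] at this ⊢
          simp only [M, Matrix.map_apply, Complex.coe_algebraMap]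
          exact_mod_cast this
      refine le_trans (le_of_eq ?_) (le_iSup₂ (f := fun k (_ : k ∈ spectrum ℂ M) => (‖k‖₊ : ENNReal)) _ hmem)
      rw [ENNReal.ofReal, ENNReal.coe_inj]
      ext
      simp [hρ.le, abs_of_pos hρ]
  rw [specRadius, key, ENNReal.toReal_ofReal hρ.le]

/-- Under a primitive matrix, every vector aligns with the positive eigenvector. -/
theorem Matrix.IsPrimitive.exists_tendsto_pow_mulVec [Nonempty n] {N : Matrix n n ℝ}
    (hN : N.IsPrimitive) {ρ : ℝ} (hρ : 0 < ρ) {r : n → ℝ} (hr : ∀ i, 0 < r i)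
    (h : N *ᵥ r = ρ • r) {f : n → ℝ} (hf : ∀ i, 0 < f i) :
    ∃ β : ℝ, 0 < β ∧ ∀ i, Tendsto (fun k => ((N ^ k) *ᵥ f) i / ρ ^ k) atTop (𝓝 (β * r i)) := by
  -- Conjugating N / ρ by the diagonal matrix of r (Doob transform) gives a primitive stochastic
  -- matrix.
  let Q : Matrix n n ℝ := fun i j => N i j * r j / (ρ * r i)
  have hpow : ∀ k i j, (Q ^ k) i j = (N ^ k) i j * r j / (ρ ^ k * r i) := by
    intro k
    induction k with
    | zero =>
      intro i j
      by_cases hij : i = j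
      · subst hij; simp [(hr i).ne']
      · simp [hij]
    | succ k ih =>
      intro i j
      simp only [pow_succ, Matrix.mul_apply, ih, Finset.sum_mul, Finset.sum_div]
      refine Finset.sum_congr rfl fun q _ => ?_
      have := (hr q).ne'
      have := (hr i).ne'
      simp only [Q]
      field_simp
  have hQ : Q.IsPrimitive := by
    obtain ⟨hnn, m, hm, hpos⟩ := hN
    refine ⟨fun i j => ?_, m, hm, fun i j => ?_⟩
    · exact div_nonneg (mul_nonneg (hnn i j) (hr j).le) (mul_pos hρ (hr i)).le
    · rw [hpow]
      exact div_pos (mul_pos (hpos i j) (hr j)) (mul_pos (pow_pos hρ m) (hr i))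
  have hs : ∀ i, ∑ j, Q i j = 1 := by
    intro i
    have := congrFun h i
    simp only [Matrix.mulVec, dotProduct, Pi.smul_apply, smul_eq_mul] at this
    simp only [Q, ← Finset.sum_div, this]
    exact div_self (mul_pos hρ (hr i)).ne'
  obtain ⟨β, ⟨i₀, hi₀⟩, hβ⟩ := exists_tendsto_pow_mulVec_of_stochastic hQ hs fun i => f i / r i
  refine ⟨β, (div_pos (hf i₀) (hr i₀)).trans_le hi₀, fun i => ?_⟩
  refine ((hβ i).mul_const (r i)).congr fun k => ?_
  simp only [Matrix.mulVec, dotProduct, hpow, Finset.sum_mul, Finset.sum_div]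
  refine Finset.sum_congr rfl fun j _ => ?_
  have := (hr j).ne'
  have := (hr i).ne'
  field_simp

/-- Read the eigenvalue equation in the row where r is smallest. -/
theorem one_le_of_pos_eigenvector {ι : Type*} [Fintype ι] [Nonempty ι] {N : Matrix ι ι ℝ} (hN : ∀ i j, 0 ≤ N i j)
    (hrow : ∀ i, 1 ≤ ∑ j, N i j) {ρ : ℝ} {r : ι → ℝ} (hr : ∀ i, 0 < r i)
    (h : N *ᵥ r = ρ • r) : 1 ≤ ρ := by
  obtain ⟨i, hi⟩ := Finite.exists_min r
  have h1 : ρ * r i = ∑ j, N i j * r j := (congrFun h i).symm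
  have h2 : ∑ j, N i j * r i ≤ ∑ j, N i j * r j :=
    Finset.sum_le_sum fun j _ => mul_le_mul_of_nonneg_left (hi j) (hN i j)
  rw [← Finset.sum_mul] at h2
  have h3 := mul_le_mul_of_nonneg_right (hrow i) (hr i).le
  exact le_of_mul_le_mul_right (by linarith) (hr i)

/-- If the row sums of a primitive matrix are at least `1` and `1` is its Perron root, then its
positive eigenvectors are constant. -/
theorem Matrix.IsPrimitive.eigenvector_const [Nonempty n] {N : Matrix n n ℝ} (hN : N.IsPrimitive)
    (hrow : ∀ i, 1 ≤ ∑ j, N i j) {r : n → ℝ} (hr : ∀ i, 0 < r i) (h : N *ᵥ r = r) :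
    ∃ c, ∀ i, r i = c := by
  obtain ⟨hnn, m, hm, hpos⟩ := hN
  have hrowm : ∀ k i, 1 ≤ ∑ j, (N ^ k) i j := by
    intro k
    induction k with
    | zero => intro i; simp [Matrix.one_apply]
    | succ k ih =>
      intro i
      simp only [pow_succ, Matrix.mul_apply]
      rw [Finset.sum_comm]
      simp only [← Finset.mul_sum]
      exact (ih i).trans (Finset.sum_le_sum fun j _ =>
        le_mul_of_one_le_right (Matrix.pow_apply_nonneg hnn k i j) (hrow j))
  -- At a minimum of r, row i of N ^ m averages values at least r i with positive weights of sum at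
  -- least 1 and returns r i; hence all values equal r i.
  obtain ⟨i, hi⟩ := Finite.exists_min r
  have hm' := congrFun (pow_mulVec_of_eigen (ρ := 1) (by simpa using h) m) i
  simp only [Matrix.mulVec, dotProduct, one_pow, one_smul] at hm'
  have hnonneg : ∀ j ∈ Finset.univ, 0 ≤ (N ^ m) i j * (r j - r i) := fun j _ =>
    mul_nonneg (hpos i j).le (sub_nonneg.2 (hi j))
  have hsum : ∑ j, (N ^ m) i j * (r j - r i) = 0 := by
    refine le_antisymm ?_ (Finset.sum_nonneg hnonneg)
    simp only [mul_sub, Finset.sum_sub_distrib, ← Finset.sum_mul, hm']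
    have := mul_le_mul_of_nonneg_right (hrowm m i) (hr i).le
    linarith
  refine ⟨r i, fun j => ?_⟩
  have := (Finset.sum_eq_zero_iff_of_nonneg hnonneg).1 hsum j (Finset.mem_univ j)
  rcases mul_eq_zero.1 this with h0 | h0
  · exact absurd h0 (hpos i j).ne'
  · linarith

end Perron

/-! ### Functions of finitely many independent choices -/

noncomputable section FiniteDependence

variable {I : Type*} {κ : I → Type*} [∀ i, MeasurableSpace (κ i)] [∀ i, Finite (κ i)]
  [∀ i, MeasurableSingletonClass (κ i)] {F : Finset I} {g : (∀ i, κ i) → ℝ}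

/-- Such a function factors through a finite type, on which every map is measurable (and, below,
bounded). -/
theorem DependsOn.measurable_of_finite (hg : DependsOn g F) : Measurable g := by
  obtain ⟨φ, rfl⟩ := dependsOn_iff_exists_comp.1 hg
  exact (measurable_of_finite φ).comp (measurable_pi_lambda _ fun i => measurable_pi_apply _)

theorem DependsOn.integrable_of_finite (hg : DependsOn g F) (μ : Measure (∀ i, κ i))
    [IsFiniteMeasure μ] : Integrable g μ := by
  have hm := hg.measurable_of_finite
  obtain ⟨φ, rfl⟩ := dependsOn_iff_exists_comp.1 hg
  obtain ⟨C, hC⟩ := (Set.finite_range fun u => ‖φ u‖).bddAbove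
  exact Integrable.of_bound hm.aestronglyMeasurable C (ae_of_all _ fun ω => hC ⟨_, rfl⟩)

/-- A coordinate is independent of every function of finitely many other coordinates. -/
theorem integral_mul_apply_of_dependsOn (P : ∀ i, Measure (κ i)) [∀ i, IsProbabilityMeasure (P i)]
    (hg : DependsOn g F) {a : I} (ha : a ∉ F) (ψ : κ a → ℝ) :
    ∫ ω, g ω * ψ (ω a) ∂Measure.infinitePi P =
      (∫ ω, g ω ∂Measure.infinitePi P) * ∫ k, ψ k ∂P a := by
  have hgm := hg.measurable_of_finite
  obtain ⟨φ, rfl⟩ := dependsOn_iff_exists_comp.1 hg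
  have hind := (ProbabilityTheory.iIndepFun_infinitePi (P := P) (X := fun i (x : κ i) => x)
    fun i => measurable_id).indepFun_finset F {a} (by simpa using ha) fun i => measurable_pi_apply i
  have hψ : Measurable ψ := measurable_of_finite ψ
  have h2 := hind.comp (φ := φ) (ψ := fun u => ψ (u ⟨a, by simp⟩)) (measurable_of_finite φ)
    (measurable_of_finite _)
  have h3 := h2.integral_fun_mul_eq_mul_integral hgm.aestronglyMeasurable
    (hψ.comp (measurable_pi_apply a)).aestronglyMeasurable
  refine Eq.trans h3 ?_
  congr 1
  have hmp := measurePreserving_eval_infinitePi P a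
  rw [← hmp.map_eq, integral_map hmp.measurable.aemeasurable hψ.aestronglyMeasurable]
  rfl

/-- A sum of centred functions of distinct coordinates, the summands being selected by functions of
other coordinates, is uncorrelated with these. -/
theorem integral_mul_sum_eq_zero (P : ∀ i, Measure (κ i)) [∀ i, IsProbabilityMeasure (P i)]
    {T : Finset I} (hT : Disjoint F T) (h : I → (∀ i, κ i) → ℝ)
    (hh : ∀ a ∈ T, DependsOn (h a) F) (ψ : ∀ a, κ a → ℝ) (hψ : ∀ a ∈ T, ∫ k, ψ a k ∂P a = 0) :
    ∫ ω, ∑ a ∈ T, h a ω * ψ a (ω a) ∂Measure.infinitePi P = 0 := by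
  classical
  rw [integral_finsetSum]
  · refine Finset.sum_eq_zero fun a ha => ?_
    rw [integral_mul_apply_of_dependsOn P (hh a ha) (Finset.disjoint_right.1 hT ha), hψ a ha,
      mul_zero]
  · intro a ha
    refine DependsOn.integrable_of_finite (F := insert a F) (fun x y hxy => ?_) _
    rw [hh a ha fun i hi => hxy i (by simp_all), hxy a (by simp)]

/-- The second moment of a sum of centred functions of distinct coordinates, the summands being
selected by functions of other coordinates. -/
theorem integral_mul_sq_sum (P : ∀ i, Measure (κ i)) [∀ i, IsProbabilityMeasure (P i)]
    {T : Finset I} (hT : Disjoint F T) (hg : DependsOn g F) (h : I → (∀ i, κ i) → ℝ)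
    (hh : ∀ a ∈ T, DependsOn (h a) F) (ψ : ∀ a, κ a → ℝ) (hψ : ∀ a ∈ T, ∫ k, ψ a k ∂P a = 0) :
    ∫ ω, g ω * (∑ a ∈ T, h a ω * ψ a (ω a)) ^ 2 ∂Measure.infinitePi P =
      ∫ ω, g ω * ∑ a ∈ T, h a ω ^ 2 * ψ a (ω a) ^ 2 ∂Measure.infinitePi P := by
  classical
  have hdep : ∀ a ∈ T, ∀ b ∈ T,
      DependsOn (fun ω : ∀ i, κ i => g ω * (h a ω * ψ a (ω a) * (h b ω * ψ b (ω b))))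
        (F ∪ T : Finset I) := by
    intro a ha b hb x y hxy
    have hF : ∀ i ∈ (F : Set I), x i = y i := fun i hi => hxy i (by simp_all)
    simp only
    rw [hg hF, hh a ha hF, hh b hb hF, hxy a (by simp [ha]), hxy b (by simp [hb])]
  have hint : ∀ a ∈ T, ∀ b ∈ T,
      Integrable (fun ω : ∀ i, κ i => g ω * (h a ω * ψ a (ω a) * (h b ω * ψ b (ω b))))
        (Measure.infinitePi P) := fun a ha b hb => (hdep a ha b hb).integrable_of_finite _
  simp only [sq (∑ a ∈ T, _), Finset.sum_mul_sum]
  simp only [Finset.mul_sum]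
  rw [integral_finsetSum _ fun a ha => integrable_finsetSum _ fun b hb => hint a ha b hb,
    integral_finsetSum]
  · refine Finset.sum_congr rfl fun a ha => ?_
    rw [integral_finsetSum _ fun b hb => hint a ha b hb, Finset.sum_eq_single a]
    · refine integral_congr_ae (ae_of_all _ fun ω => ?_)
      simp only
      ring
    -- Off the diagonal, the choice at b is independent of all the other factors and centred, so the
    -- cross term vanishes.
    · intro b hb hba
      have hd : DependsOn (fun ω : ∀ i, κ i => g ω * (h a ω * ψ a (ω a) * h b ω))
          (insert a F : Finset I) := by
        intro x y hxy
        have hF : ∀ i ∈ (F : Set I), x i = y i := fun i hi => hxy i (by simp_all)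
        simp only
        rw [hg hF, hh a ha hF, hh b hb hF, hxy a (by simp)]
      have hbn : b ∉ insert a F := by
        simp [hba, Finset.disjoint_right.1 hT hb]
      have := integral_mul_apply_of_dependsOn P hd hbn (ψ b)
      rw [hψ b hb, mul_zero] at this
      rw [← this]
      refine integral_congr_ae (ae_of_all _ fun ω => ?_)
      simp only
      ring
    · exact fun hn => absurd ha hn
  · intro a ha
    refine (hint a ha a ha).congr (ae_of_all _ fun ω => ?_)
    simp only
    ring

end FiniteDependence

/-! ### Limit theory for vector processes with linear mean growth -/

noncomputable section MeanGrowth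

open scoped Matrix

/-- With the minimum and maximum of r as constants, the Perron-weighted sum and the total are
interchangeable up to constants. -/
theorem exists_dotProduct_bounds {Y : Type*} [Fintype Y] [Nonempty Y] {r : Y → ℝ}
    (hr : ∀ y, 0 < r y) : ∃ a b : ℝ, 0 < a ∧ 0 < b ∧ ∀ x : Y → ℝ, (∀ y, 0 ≤ x y) →
      a * (x ⬝ᵥ 1) ≤ x ⬝ᵥ r ∧ x ⬝ᵥ r ≤ b * (x ⬝ᵥ 1) := by
  obtain ⟨y₀, h₀⟩ := Finite.exists_min r
  obtain ⟨y₁, h₁⟩ := Finite.exists_max r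
  refine ⟨r y₀, r y₁, hr _, hr _, fun x hx => ⟨?_, ?_⟩⟩ <;>
  · simp only [dotProduct, Finset.mul_sum, Pi.one_apply]
    refine Finset.sum_le_sum fun y _ => ?_
    nlinarith [hx y, h₀ y, h₁ y]

/-- Tonelli and a geometric series. It serves both for almost sure summability and, through Markov's
inequality, for the positivity of the limit. -/
theorem lintegral_tsum_ofReal_le_of_geometric {Ω : Type*} [MeasurableSpace Ω] {μ : Measure Ω}
    {f : ℕ → Ω → ℝ} (hf : ∀ k ω, 0 ≤ f k ω) (hi : ∀ k, Integrable (f k) μ) {c θ : ℝ}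
    (hθ : 0 ≤ θ) (hθ1 : θ < 1) (h : ∀ k, ∫ ω, f k ω ∂μ ≤ θ ^ k * c) :
    ∫⁻ ω, ∑' k, ENNReal.ofReal (f k ω) ∂μ ≤ ENNReal.ofReal ((1 - θ)⁻¹ * c) := by
  have hc : 0 ≤ c := by simpa using (integral_nonneg (hf 0)).trans (h 0)
  rw [lintegral_tsum fun k => (hi k).aestronglyMeasurable.aemeasurable.ennreal_ofReal]
  calc ∑' k, ∫⁻ ω, ENNReal.ofReal (f k ω) ∂μ
      = ∑' k, ENNReal.ofReal (∫ ω, f k ω ∂μ) := by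
        congr 1
        ext k
        rw [ofReal_integral_eq_lintegral_ofReal (hi k) (ae_of_all _ (hf k))]
    _ ≤ ∑' k, ENNReal.ofReal (θ ^ k * c) :=
        ENNReal.tsum_le_tsum fun k => ENNReal.ofReal_le_ofReal (h k)
    _ = ENNReal.ofReal ((1 - θ)⁻¹ * c) := by
        rw [← ENNReal.ofReal_tsum_of_nonneg (fun k => mul_nonneg (pow_nonneg hθ k) hc)
          ((summable_geometric_of_lt_one hθ hθ1).mul_right c), tsum_mul_right,
          tsum_geometric_of_lt_one hθ hθ1]

/-- If `x t` evolves by `N` up to errors that are `o(ρ ^ t)` when tested against the vectors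
`N ^ k *ᵥ f`, then `x t ⬝ᵥ f / ρ ^ t` converges as soon as `x t ⬝ᵥ r / ρ ^ t` does. -/
theorem tendsto_dotProduct_div_pow {Y : Type*} [Fintype Y] [DecidableEq Y] [Nonempty Y]
    {N : Matrix Y Y ℝ} {ρ β w : ℝ} (hρ : 0 < ρ) {r f : Y → ℝ} (hr : ∀ y, 0 < r y)
    (hlim : ∀ y, Tendsto (fun k => ((N ^ k) *ᵥ f) y / ρ ^ k) atTop (𝓝 (β * r y)))
    {x : ℕ → Y → ℝ} (hx : ∀ t y, 0 ≤ x t y)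
    (herr : ∀ k, Tendsto (fun t => (x (t + 1) ⬝ᵥ ((N ^ k) *ᵥ f) -
      x t ⬝ᵥ (N *ᵥ ((N ^ k) *ᵥ f))) / ρ ^ t) atTop (𝓝 0))
    (hw : Tendsto (fun t => x t ⬝ᵥ r / ρ ^ t) atTop (𝓝 w)) :
    Tendsto (fun t => x t ⬝ᵥ f / ρ ^ t) atTop (𝓝 (β * w)) := by
  obtain ⟨a, b, ha, hb, hab⟩ := exists_dotProduct_bounds hr
  -- For a fixed number n of steps, the one-step errors telescope.
  have hmany : ∀ n k, Tendsto (fun t => (x (t + n) ⬝ᵥ ((N ^ k) *ᵥ f) -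
      x t ⬝ᵥ ((N ^ (n + k)) *ᵥ f)) / ρ ^ t) atTop (𝓝 0) := by
    intro n
    induction n with
    | zero => intro k; simp
    | succ n ih =>
      intro k
      have h1 := ((herr k).comp (tendsto_add_atTop_nat n)).const_mul (ρ ^ n)
      have h2 := h1.add (ih (k + 1))
      simp only [mul_zero, add_zero] at h2
      refine h2.congr fun t => ?_
      simp only [Function.comp_def]
      rw [Matrix.mulVec_mulVec, ← pow_succ', show n + 1 + k = n + (k + 1) by ring,
        show t + (n + 1) = t + n + 1 by ring, pow_add ρ t n]
      field_simp
      ring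
  obtain ⟨B, hB⟩ := hw.bddAbove_range
  have hB0 : ∀ t, x t ⬝ᵥ 1 / ρ ^ t ≤ a⁻¹ * B := by
    intro t
    have h1 : x t ⬝ᵥ r / ρ ^ t ≤ B := hB ⟨t, rfl⟩
    have h2 := (hab (x t) (hx t)).1
    rw [le_inv_mul_iff₀ ha, ← mul_div_assoc]
    exact (div_le_div_of_nonneg_right h2 (pow_pos hρ t).le).trans h1
  have hBB : 0 ≤ a⁻¹ * B := (hB0 0).trans' (by
    simp only [pow_zero, div_one]
    exact Finset.sum_nonneg fun y _ => mul_nonneg (hx 0 y) zero_le_one)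
  rw [Metric.tendsto_nhds]
  intro ε hε
  -- The total over ρ ^ t is at most a⁻¹ B, so replacing N ^ n f / ρ ^ n by β r will cost at most ε
  -- / 3.
  set δ := ε / (3 * (a⁻¹ * B + 1)) with hδdef
  have hδ : 0 < δ := by positivity
  have hδB : δ * (a⁻¹ * B) ≤ ε / 3 := by
    rw [hδdef, div_mul_eq_mul_div, div_le_div_iff₀ (by positivity) (by norm_num)]
    nlinarith
  -- First n is fixed to align N ^ n f with r; only then does t tend to infinity.
  obtain ⟨n, hn⟩ := (eventually_all.2 fun y =>
    (Metric.tendsto_nhds.1 (hlim y) δ hδ)).exists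
  have e1 := Metric.tendsto_nhds.1 ((hmany n 0).const_mul (ρ ^ n)⁻¹) (ε / 3) (by positivity)
  have e2 := Metric.tendsto_nhds.1 (hw.const_mul β) (ε / 3) (by positivity)
  rw [← map_add_atTop_eq_nat n, eventually_map]
  filter_upwards [e1, e2] with t h1 h2
  simp only [Real.dist_eq, pow_zero, Matrix.one_mulVec, mul_zero, sub_zero, add_zero] at h1 h2 hn ⊢
  have h3 : |x t ⬝ᵥ ((N ^ n) *ᵥ f) / (ρ ^ n * ρ ^ t) - β * (x t ⬝ᵥ r / ρ ^ t)| ≤ ε / 3 := by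
    have : x t ⬝ᵥ ((N ^ n) *ᵥ f) / (ρ ^ n * ρ ^ t) - β * (x t ⬝ᵥ r / ρ ^ t) =
        (∑ y, x t y * (((N ^ n) *ᵥ f) y / ρ ^ n - β * r y)) / ρ ^ t := by
      simp only [mul_sub, Finset.sum_sub_distrib, sub_div, dotProduct, Finset.mul_sum,
        Finset.sum_div]
      congr 1 <;> refine Finset.sum_congr rfl fun y _ => ?_
      · field_simp
      · field_simp
    rw [this, abs_div, abs_of_pos (pow_pos hρ t)]
    refine le_trans ?_ hδB
    calc |∑ y, x t y * (((N ^ n) *ᵥ f) y / ρ ^ n - β * r y)| / ρ ^ t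
        ≤ (∑ y, x t y * δ) / ρ ^ t := by
          refine div_le_div_of_nonneg_right ?_ (pow_pos hρ t).le
          refine (Finset.abs_sum_le_sum_abs _ _).trans (Finset.sum_le_sum fun y _ => ?_)
          rw [abs_mul, abs_of_nonneg (hx t y)]
          exact mul_le_mul_of_nonneg_left (hn y).le (hx t y)
      _ = δ * (x t ⬝ᵥ 1 / ρ ^ t) := by
          rw [← Finset.sum_mul]
          simp only [dotProduct, Pi.one_apply, mul_one]
          ring
      _ ≤ _ := mul_le_mul_of_nonneg_left (hB0 t) hδ.le
  have h4 : x (t + n) ⬝ᵥ f / ρ ^ (t + n) - β * w =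
      (ρ ^ n)⁻¹ * ((x (t + n) ⬝ᵥ f - x t ⬝ᵥ ((N ^ n) *ᵥ f)) / ρ ^ t) +
      (x t ⬝ᵥ ((N ^ n) *ᵥ f) / (ρ ^ n * ρ ^ t) - β * (x t ⬝ᵥ r / ρ ^ t)) +
      (β * (x t ⬝ᵥ r / ρ ^ t) - β * w) := by
    rw [pow_add]
    field_simp
    ring
  rw [h4]
  refine lt_of_le_of_lt ((abs_add_le _ _).trans (add_le_add_left (abs_add_le _ _) _)) ?_
  linarith

variable {I : Type*} {κ : I → Type*} [∀ i, MeasurableSpace (κ i)] {Y : Type*} [Fintype Y]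

/-- A process of non-negative vectors, the vector at time `t` being determined by finitely many
coordinates, whose total never decreases, grows at most by a constant factor per step, and is never
in the interval `(0, 1)`, and whose conditional mean evolves by the matrix `N`, the conditional
variance being at most proportional to the total. -/
structure IsMeanGrowth (μ : Measure (∀ i, κ i)) (F : ℕ → Finset I) (N : Matrix Y Y ℝ)
    (x : ℕ → (∀ i, κ i) → Y → ℝ) : Prop where
  mono : Monotone F
  dep : ∀ t, DependsOn (x t) (F t : Set I)
  nonneg : ∀ t ω y, 0 ≤ x t ω y
  eq_zero_or_one_le : ∀ t ω, x t ω ⬝ᵥ 1 = 0 ∨ 1 ≤ x t ω ⬝ᵥ 1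
  total_mono : ∀ t ω, x t ω ⬝ᵥ 1 ≤ x (t + 1) ω ⬝ᵥ 1
  total_le : ∃ M : ℝ, 0 ≤ M ∧ ∀ t ω, x (t + 1) ω ⬝ᵥ 1 ≤ M * (x t ω ⬝ᵥ 1)
  mean : ∀ (t : ℕ) (f : Y → ℝ) (g : (∀ i, κ i) → ℝ), DependsOn g (F t : Set I) →
    ∫ ω, g ω * (x (t + 1) ω ⬝ᵥ f - x t ω ⬝ᵥ (N *ᵥ f)) ∂μ = 0
  var : ∀ f : Y → ℝ, ∃ C : ℝ, 0 ≤ C ∧ ∀ (t : ℕ) (g : (∀ i, κ i) → ℝ),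
    DependsOn g (F t : Set I) → (∀ ω, 0 ≤ g ω) →
    ∫ ω, g ω * (x (t + 1) ω ⬝ᵥ f - x t ω ⬝ᵥ (N *ᵥ f)) ^ 2 ∂μ ≤ C * ∫ ω, g ω * (x t ω ⬝ᵥ 1) ∂μ

namespace IsMeanGrowth

variable {μ : Measure (∀ i, κ i)} {F : ℕ → Finset I} {N : Matrix Y Y ℝ}
  {x : ℕ → (∀ i, κ i) → Y → ℝ}

theorem dep_of_le (hx : IsMeanGrowth μ F N x) {t u : ℕ} (h : t ≤ u) :
    DependsOn (x t) (F u : Set I) :=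
  (hx.dep t).mono (Finset.coe_subset.2 (hx.mono h))

variable [∀ i, Finite (κ i)] [∀ i, MeasurableSingletonClass (κ i)] [IsProbabilityMeasure μ]

theorem integrable (hx : IsMeanGrowth μ F N x) {t : ℕ} {g : (∀ i, κ i) → ℝ}
    (hg : DependsOn g (F t : Set I)) (f : Y → ℝ) :
    Integrable (fun ω => g ω * (x t ω ⬝ᵥ f)) μ :=
  DependsOn.integrable_of_finite (F := F t) (fun ω η h => by simp only [hg h, hx.dep t h]) μ

theorem integral_mul_succ (hx : IsMeanGrowth μ F N x) (t : ℕ) {g : (∀ i, κ i) → ℝ}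
    (hg : DependsOn g (F t : Set I)) (f : Y → ℝ) :
    ∫ ω, g ω * (x (t + 1) ω ⬝ᵥ f) ∂μ = ∫ ω, g ω * (x t ω ⬝ᵥ (N *ᵥ f)) ∂μ := by
  have h := hx.mean t f g hg
  simp only [mul_sub] at h
  rw [integral_sub (hx.integrable (hg.mono (Finset.coe_subset.2 (hx.mono t.le_succ))) f)
    (hx.integrable hg _)] at h
  linarith

/-- This is the martingale property of x t ⬝ᵥ r / ρ ^ t; conditioning on the past is expressed by
the arbitrary test function g of the coordinates in F t. -/
theorem integral_mul_add (hx : IsMeanGrowth μ F N x) {ρ : ℝ} {r : Y → ℝ} (h : N *ᵥ r = ρ • r)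
    (t : ℕ) {g : (∀ i, κ i) → ℝ} (hg : DependsOn g (F t : Set I)) (k : ℕ) :
    ∫ ω, g ω * (x (t + k) ω ⬝ᵥ r) ∂μ = ρ ^ k * ∫ ω, g ω * (x t ω ⬝ᵥ r) ∂μ := by
  induction k with
  | zero => simp
  | succ k ih =>
    rw [← add_assoc, hx.integral_mul_succ (t + k)
      (hg.mono (Finset.coe_subset.2 (hx.mono (Nat.le_add_right t k)))), h, pow_succ', mul_assoc,
      ← ih, ← integral_const_mul]
    refine integral_congr_ae (ae_of_all _ fun ω => ?_)
    simp only [dotProduct_smul, smul_eq_mul]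
    ring

/-- In the critical case the total of the process is constant. -/
theorem ae_total_eq (hx : IsMeanGrowth μ F N x) (hrow : N *ᵥ 1 = 1) :
    ∀ᵐ ω ∂μ, ∀ t, x t ω ⬝ᵥ 1 = x 0 ω ⬝ᵥ 1 := by
  have h1 : ∀ t, ∀ᵐ ω ∂μ, x (t + 1) ω ⬝ᵥ 1 = x t ω ⬝ᵥ 1 := by
    intro t
    have h0 := hx.mean t 1 (fun _ => 1) fun _ _ _ => rfl
    simp only [one_mul, hrow] at h0
    have hi : Integrable (fun ω => x (t + 1) ω ⬝ᵥ 1 - x t ω ⬝ᵥ 1) μ :=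
      DependsOn.integrable_of_finite (F := F (t + 1)) (fun ω η hω => by
        simp only [hx.dep (t + 1) hω, hx.dep_of_le t.le_succ hω]) μ
    have h2 := (integral_eq_zero_iff_of_nonneg
      (fun ω => sub_nonneg.2 (hx.total_mono t ω)) hi).1 h0
    filter_upwards [h2] with ω hω
    exact sub_eq_zero.1 hω
  filter_upwards [ae_all_iff.2 h1] with ω hω t
  induction t with
  | zero => rfl
  | succ t ih => rw [hω t, ih]

variable [Nonempty Y]

/-- The error after k further steps has second moment of order ρ ^ k, hence mean size of order ρ ^
(k / 2). The weight g is taken to be 1 for summability and the inverse of x t ⬝ᵥ r for positivity of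
the limit, where the free constant c is finally sent to 0. -/
theorem exists_integral_abs_le (hx : IsMeanGrowth μ F N x) {ρ : ℝ} (hρ : 0 < ρ) {r : Y → ℝ}
    (hr : ∀ y, 0 < r y) (h : N *ᵥ r = ρ • r) (f : Y → ℝ) :
    ∃ C : ℝ, 0 ≤ C ∧ ∀ (t : ℕ) (g : (∀ i, κ i) → ℝ), DependsOn g (F t : Set I) →
      (∀ ω, 0 ≤ g ω) → ∀ c : ℝ, 0 < c → ∀ k : ℕ,
      ∫ ω, g ω * |x (t + k + 1) ω ⬝ᵥ f - x (t + k) ω ⬝ᵥ (N *ᵥ f)| / ρ ^ k ∂μ ≤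
        (√ρ)⁻¹ ^ k * (c + C * (∫ ω, g ω ^ 2 * (x t ω ⬝ᵥ r) ∂μ) / c) := by
  obtain ⟨a, b, ha, hb, hab⟩ := exists_dotProduct_bounds hr
  obtain ⟨C, hC, hvar⟩ := hx.var f
  refine ⟨C * a⁻¹, by positivity, fun t g hg hg0 c hc k => ?_⟩
  have hgk : DependsOn g (F (t + k) : Set I) :=
    hg.mono (Finset.coe_subset.2 (hx.mono (Nat.le_add_right t k)))
  have hgk2 : DependsOn (fun ω => g ω ^ 2) (F (t + k) : Set I) := fun ω η hω => by
    simp only [hgk hω]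
  have hg2 : DependsOn (fun ω => g ω ^ 2) (F t : Set I) := fun ω η hω => by
    simp only [hg hω]
  set D : (∀ i, κ i) → ℝ := fun ω => x (t + k + 1) ω ⬝ᵥ f - x (t + k) ω ⬝ᵥ (N *ᵥ f) with hD
  have hgs : DependsOn g (F (t + k + 1) : Set I) :=
    hgk.mono (Finset.coe_subset.2 (hx.mono (Nat.le_succ _)))
  have hDdep : DependsOn D (F (t + k + 1) : Set I) := fun ω η hω => by
    simp only [hD, hx.dep (t + k + 1) hω, hx.dep_of_le (Nat.le_succ (t + k)) hω]
  set σ := √ρ with hσ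
  have hσ0 : 0 < σ := Real.sqrt_pos.2 hρ
  have hσ2 : ρ = σ * σ := (Real.mul_self_sqrt hρ.le).symm
  have hv := hvar (t + k) (fun ω => g ω ^ 2) hgk2 fun ω => sq_nonneg _
  have hX : ∫ ω, g ω ^ 2 * (x (t + k) ω ⬝ᵥ 1) ∂μ ≤
      a⁻¹ * (ρ ^ k * ∫ ω, g ω ^ 2 * (x t ω ⬝ᵥ r) ∂μ) := by
    rw [← hx.integral_mul_add h t hg2 k, ← integral_const_mul]
    refine integral_mono (hx.integrable hgk2 1) ((hx.integrable hgk2 r).const_mul _) fun ω => ?_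
    have := (hab (x (t + k) ω) (hx.nonneg _ ω)).1
    simp only
    rw [le_inv_mul_iff₀ ha]
    nlinarith [sq_nonneg (g ω)]
  -- Instead of Cauchy–Schwarz: u ≤ q + u² / q for u = g |D|, with q = σ ^ k c balancing the two
  -- terms because u² has mean of order ρ ^ k = σ ^ (2k).
  have hpt : ∀ ω, g ω * |D ω| / ρ ^ k ≤
      σ⁻¹ ^ k * c + (σ⁻¹ ^ k / (ρ ^ k * c)) * (g ω ^ 2 * D ω ^ 2) := by
    intro ω
    have h1 : 0 ≤ (g ω * |D ω| - σ ^ k * c) ^ 2 := sq_nonneg _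
    have h2 : 0 ≤ g ω * |D ω| := mul_nonneg (hg0 ω) (abs_nonneg _)
    have h3 : 0 < σ ^ k * c := by positivity
    have h4 : g ω * |D ω| ≤ σ ^ k * c + (g ω * |D ω|) ^ 2 / (σ ^ k * c) := by
      rw [← sub_le_iff_le_add', le_div_iff₀ h3]
      nlinarith
    have h5 : σ⁻¹ ^ k * c + (σ⁻¹ ^ k / (ρ ^ k * c)) * (g ω ^ 2 * D ω ^ 2) =
        (σ ^ k * c + (g ω * |D ω|) ^ 2 / (σ ^ k * c)) / ρ ^ k := by
      rw [mul_pow, sq_abs, hσ2, mul_pow, inv_pow]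
      field_simp
    rw [h5]
    exact div_le_div_of_nonneg_right h4 (pow_pos hρ k).le
  have hi2 : Integrable (fun ω => g ω ^ 2 * D ω ^ 2) μ :=
    DependsOn.integrable_of_finite (F := F (t + k + 1))
      (fun ω η hω => by simp only [hgs hω, hDdep hω]) μ
  calc ∫ ω, g ω * |D ω| / ρ ^ k ∂μ
      ≤ ∫ ω, (σ⁻¹ ^ k * c + (σ⁻¹ ^ k / (ρ ^ k * c)) * (g ω ^ 2 * D ω ^ 2)) ∂μ :=
        integral_mono (DependsOn.integrable_of_finite (F := F (t + k + 1))
          (fun ω η hω => by simp only [hgs hω, hDdep hω]) μ)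
          ((integrable_const _).add (hi2.const_mul _)) hpt
    _ = σ⁻¹ ^ k * c + (σ⁻¹ ^ k / (ρ ^ k * c)) * ∫ ω, g ω ^ 2 * D ω ^ 2 ∂μ := by
        rw [integral_add (integrable_const _) (hi2.const_mul _), integral_const,
          integral_const_mul, probReal_univ, one_smul]
    _ ≤ σ⁻¹ ^ k * c + (σ⁻¹ ^ k / (ρ ^ k * c)) *
          (C * (a⁻¹ * (ρ ^ k * ∫ ω, g ω ^ 2 * (x t ω ⬝ᵥ r) ∂μ))) := by
        gcongr
        exact hv.trans (mul_le_mul_of_nonneg_left hX hC)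
    _ = _ := by
        field_simp

/-- The sum has finite expectation, dominated by a geometric series of ratio 1 / √ρ. -/
theorem ae_summable (hx : IsMeanGrowth μ F N x) {ρ : ℝ} (hρ : 1 < ρ) {r : Y → ℝ}
    (hr : ∀ y, 0 < r y) (h : N *ᵥ r = ρ • r) (f : Y → ℝ) :
    ∀ᵐ ω ∂μ, Summable fun t => |x (t + 1) ω ⬝ᵥ f - x t ω ⬝ᵥ (N *ᵥ f)| / ρ ^ t := by
  have hρ0 : 0 < ρ := zero_lt_one.trans hρ
  obtain ⟨C, hC, hbd⟩ := hx.exists_integral_abs_le hρ0 hr h f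
  have hσ : 1 < √ρ := Real.lt_sqrt_of_sq_lt (by simpa using hρ)
  have hdep : ∀ t, DependsOn (fun ω => |x (t + 1) ω ⬝ᵥ f - x t ω ⬝ᵥ (N *ᵥ f)| / ρ ^ t)
      (F (t + 1) : Set I) := fun t ω η hω => by
    simp only [hx.dep (t + 1) hω, hx.dep_of_le (Nat.le_succ t) hω]
  have hfin := lintegral_tsum_ofReal_le_of_geometric (μ := μ)
    (f := fun t ω => |x (t + 1) ω ⬝ᵥ f - x t ω ⬝ᵥ (N *ᵥ f)| / ρ ^ t)
    (fun t ω => by positivity) (fun t => (hdep t).integrable_of_finite μ)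
    (inv_nonneg.2 (Real.sqrt_nonneg ρ)) (inv_lt_one_of_one_lt₀ hσ)
    (fun k => by
      have := hbd 0 (fun _ => 1) (fun _ _ _ => rfl) (fun _ => zero_le_one) 1 one_pos k
      simpa using this)
  have hm : Measurable fun ω => ∑' t, ENNReal.ofReal
      (|x (t + 1) ω ⬝ᵥ f - x t ω ⬝ᵥ (N *ᵥ f)| / ρ ^ t) :=
    Measurable.tsum fun t => (hdep t).measurable_of_finite.ennreal_ofReal
  filter_upwards [ae_lt_top hm (hfin.trans_lt ENNReal.ofReal_lt_top).ne] with ω hω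
  refine (ENNReal.summable_toReal hω.ne).congr fun t => ?_
  exact ENNReal.toReal_ofReal (by positivity)

open Classical in
-- On the event that the total is at most K, the weighted sum grows in mean by the factor ρ. It can
-- leave this event only once, the total being monotone, and carries away at most b M K when it
-- does. So A t, corrected by b M K times the probability of the event, is bounded and increases by
-- at least (ρ - 1) A t at each step; hence A t tends to 0.
theorem tendsto_integral_truncated (hx : IsMeanGrowth μ F N x) {ρ : ℝ} (hρ : 1 < ρ) {r : Y → ℝ}
    (hr : ∀ y, 0 < r y) (h : N *ᵥ r = ρ • r) {K : ℝ} (hK : 0 ≤ K) :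
    Tendsto (fun t => ∫ ω, (if x t ω ⬝ᵥ 1 ≤ K then 1 else 0) * (x t ω ⬝ᵥ r) ∂μ) atTop (𝓝 0) := by
  obtain ⟨a, b, ha, hb, hab⟩ := exists_dotProduct_bounds hr
  obtain ⟨M, hM, hXM⟩ := hx.total_le
  set g : ℕ → (∀ i, κ i) → ℝ := fun t ω => if x t ω ⬝ᵥ 1 ≤ K then 1 else 0 with hg
  have hgdep : ∀ t, DependsOn (g t) (F t : Set I) := fun t ω η hω => by
    simp only [hg, hx.dep t hω]
  have hZ0 : ∀ t ω, 0 ≤ x t ω ⬝ᵥ r := fun t ω =>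
    Finset.sum_nonneg fun y _ => mul_nonneg (hx.nonneg t ω y) (hr y).le
  have hg0 : ∀ t ω, 0 ≤ g t ω := fun t ω => by simp only [hg]; split_ifs <;> norm_num
  have hgi : ∀ t, Integrable (g t) μ := fun t => (hgdep t).integrable_of_finite μ
  set A : ℕ → ℝ := fun t => ∫ ω, g t ω * (x t ω ⬝ᵥ r) ∂μ with hA
  set B : ℕ → ℝ := fun t => A t - b * (M * K) * ∫ ω, g t ω ∂μ with hB
  have hA0 : ∀ t, 0 ≤ A t := fun t => integral_nonneg fun ω => mul_nonneg (hg0 t ω) (hZ0 t ω)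
  have hstep : ∀ t, (ρ - 1) * A t ≤ B (t + 1) - B t := by
    intro t
    have hgt1 : DependsOn (g t) (F (t + 1) : Set I) :=
      (hgdep t).mono (Finset.coe_subset.2 (hx.mono t.le_succ))
    have h1 := hx.integral_mul_add h t (hgdep t) 1
    rw [pow_one] at h1
    have hpt : ∀ ω, g t ω * (x (t + 1) ω ⬝ᵥ r) ≤
        g (t + 1) ω * (x (t + 1) ω ⬝ᵥ r) + b * (M * K) * (g t ω - g (t + 1) ω) := by
      intro ω
      have hm := hx.total_mono t ω
      have hle := hXM t ω
      have hZb := (hab _ (hx.nonneg (t + 1) ω)).2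
      simp only [hg]
      split_ifs with h2 h3 h3
      · simp
      · have : b * (x (t + 1) ω ⬝ᵥ 1) ≤ b * (M * K) :=
          mul_le_mul_of_nonneg_left (hle.trans (mul_le_mul_of_nonneg_left h2 hM)) hb.le
        linarith
      · linarith
      · simp
    have hd : Integrable (fun ω => b * (M * K) * (g t ω - g (t + 1) ω)) μ :=
      ((hgi t).sub (hgi (t + 1))).const_mul _
    have h2 := integral_mono (hx.integrable hgt1 r)
      ((hx.integrable (hgdep (t + 1)) r).add hd) hpt
    simp only [Pi.add_apply] at h2
    rw [integral_add (hx.integrable (hgdep (t + 1)) r) hd, integral_const_mul,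
      integral_sub (hgi t) (hgi (t + 1)), h1] at h2
    simp only [hB, hA]
    linarith
  have hmono : Monotone B := monotone_nat_of_le_succ fun t => by
    have := hstep t
    have := mul_nonneg (sub_nonneg.2 hρ.le) (hA0 t)
    linarith
  have hbdd : ∀ t, B t ≤ b * K := by
    intro t
    have h1 : A t ≤ ∫ _, b * K ∂μ := by
      refine integral_mono (hx.integrable (hgdep t) r) (integrable_const _) fun ω => ?_
      have hZb := (hab _ (hx.nonneg t ω)).2
      simp only [hg]
      split_ifs with h2
      · rw [one_mul]
        exact hZb.trans (mul_le_mul_of_nonneg_left h2 hb.le)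
      · rw [zero_mul]; positivity
    have h2 : 0 ≤ ∫ ω, g t ω ∂μ := integral_nonneg (hg0 t)
    have h3 : 0 ≤ b * (M * K) * ∫ ω, g t ω ∂μ := by positivity
    simp only [integral_const, probReal_univ, one_smul] at h1
    simp only [hB]
    linarith
  have hlim := tendsto_atTop_ciSup hmono ⟨b * K, by rintro _ ⟨t, rfl⟩; exact hbdd t⟩
  have hdiff := (((tendsto_add_atTop_iff_nat 1).2 hlim).sub hlim).const_mul (ρ - 1)⁻¹
  rw [sub_self, mul_zero] at hdiff
  refine squeeze_zero hA0 (fun t => ?_) hdiff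
  rw [le_inv_mul_iff₀ (by linarith)]
  exact hstep t

/-- Where the total lies in [1, K], the weighted sum is at least a, so its inverse is at most a⁻²
times itself and the truncated integral applies; above K the inverse is at most 1 / (a K). -/
theorem tendsto_integral_inv (hx : IsMeanGrowth μ F N x) {ρ : ℝ} (hρ : 1 < ρ) {r : Y → ℝ}
    (hr : ∀ y, 0 < r y) (h : N *ᵥ r = ρ • r) :
    Tendsto (fun t => ∫ ω, (x t ω ⬝ᵥ r)⁻¹ ∂μ) atTop (𝓝 0) := by
  classical
  obtain ⟨a, b, ha, hb, hab⟩ := exists_dotProduct_bounds hr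
  have hZ0 : ∀ t ω, 0 ≤ x t ω ⬝ᵥ r := fun t ω =>
    Finset.sum_nonneg fun y _ => mul_nonneg (hx.nonneg t ω y) (hr y).le
  have hle : ∀ (K : ℝ), 0 < K → ∀ t, ∫ ω, (x t ω ⬝ᵥ r)⁻¹ ∂μ ≤
      a⁻¹ ^ 2 * (∫ ω, (if x t ω ⬝ᵥ 1 ≤ K then 1 else 0) * (x t ω ⬝ᵥ r) ∂μ) + (a * K)⁻¹ := by
    intro K hK t
    have hi : Integrable (fun ω => (if x t ω ⬝ᵥ 1 ≤ K then 1 else 0) * (x t ω ⬝ᵥ r)) μ :=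
      hx.integrable (fun ω η hω => by simp only [hx.dep t hω]) r
    have hpt : ∀ ω, (x t ω ⬝ᵥ r)⁻¹ ≤
        a⁻¹ ^ 2 * ((if x t ω ⬝ᵥ 1 ≤ K then 1 else 0) * (x t ω ⬝ᵥ r)) + (a * K)⁻¹ := by
      intro ω
      obtain ⟨h1, h2⟩ := hab _ (hx.nonneg t ω)
      have hc : 0 ≤ (a * K)⁻¹ := by positivity
      rcases hx.eq_zero_or_one_le t ω with h3 | h3
      -- Paths on which the process vanishes contribute nothing, since 0⁻¹ = 0.
      · have : x t ω ⬝ᵥ r = 0 := le_antisymm (by simpa [h3] using h2) (hZ0 t ω)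
        rwa [this, inv_zero, mul_zero, mul_zero, zero_add]
      · split_ifs with h4
        · have h5 : a ≤ x t ω ⬝ᵥ r := h1.trans' (le_mul_of_one_le_right ha.le h3)
          have h6 : (x t ω ⬝ᵥ r)⁻¹ ≤ a⁻¹ := inv_anti₀ ha h5
          have h7 : a⁻¹ ≤ a⁻¹ ^ 2 * (x t ω ⬝ᵥ r) := by
            rw [sq, mul_assoc]
            refine le_mul_of_one_le_right (by positivity) ?_
            rwa [le_inv_mul_iff₀ ha, mul_one]
          linarith
        · simp only [zero_mul, mul_zero, zero_add]
          exact inv_anti₀ (by positivity)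
            ((mul_le_mul_of_nonneg_left (not_le.1 h4).le ha.le).trans h1)
    have := integral_mono (DependsOn.integrable_of_finite (F := F t)
      (fun ω η hω => by simp only [hx.dep t hω]) μ)
      ((hi.const_mul (a⁻¹ ^ 2)).add (integrable_const (a * K)⁻¹)) hpt
    simp only [Pi.add_apply] at this
    rw [integral_add (hi.const_mul _) (integrable_const _), integral_const_mul] at this
    simpa using this
  rw [Metric.tendsto_nhds]
  intro ε hε
  set K := 2 / (a * ε)
  have hK : 0 < K := by positivity
  have hlim := (hx.tendsto_integral_truncated hρ hr h hK.le).const_mul (a⁻¹ ^ 2)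
  rw [mul_zero] at hlim
  filter_upwards [Metric.tendsto_nhds.1 hlim (ε / 2) (by positivity)] with t ht
  have h1 := hle K hK t
  have h2 : (a * K)⁻¹ = ε / 2 := by
    simp only [K]
    field_simp
  rw [Real.dist_eq, sub_zero] at ht ⊢
  rw [abs_of_nonneg (integral_nonneg fun ω => inv_nonneg.2 (hZ0 t ω))]
  have := le_abs_self (a⁻¹ ^ 2 * ∫ ω, (if x t ω ⬝ᵥ 1 ≤ K then 1 else 0) * (x t ω ⬝ᵥ r) ∂μ)
  linarith

/-- The normalised limit of a supercritical process vanishes only if the process does. -/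
theorem ae_not_tendsto_zero (hx : IsMeanGrowth μ F N x) {ρ : ℝ} (hρ : 1 < ρ) {r : Y → ℝ}
    (hr : ∀ y, 0 < r y) (h : N *ᵥ r = ρ • r) :
    ∀ᵐ ω ∂μ, 1 ≤ x 0 ω ⬝ᵥ 1 → ¬ Tendsto (fun t => x t ω ⬝ᵥ r / ρ ^ t) atTop (𝓝 0) := by
  have hρ0 : 0 < ρ := zero_lt_one.trans hρ
  obtain ⟨a, b, ha, hb, hab⟩ := exists_dotProduct_bounds hr
  obtain ⟨C, hC, hbd⟩ := hx.exists_integral_abs_le hρ0 hr h r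
  have hσ : 1 < √ρ := Real.lt_sqrt_of_sq_lt (by simpa using hρ)
  have hZ0 : ∀ t ω, 0 ≤ x t ω ⬝ᵥ r := fun t ω =>
    Finset.sum_nonneg fun y _ => mul_nonneg (hx.nonneg t ω y) (hr y).le
  set S : Set (∀ i, κ i) :=
    {ω | 1 ≤ x 0 ω ⬝ᵥ 1 ∧ Tendsto (fun t => x t ω ⬝ᵥ r / ρ ^ t) atTop (𝓝 0)} with hS
  set G : ℕ → ℕ → (∀ i, κ i) → ℝ := fun t k ω =>
    (x t ω ⬝ᵥ r)⁻¹ * |x (t + k + 1) ω ⬝ᵥ r - x (t + k) ω ⬝ᵥ (N *ᵥ r)| / ρ ^ k with hG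
  have hG0 : ∀ t k ω, 0 ≤ G t k ω := fun t k ω => by
    have := hZ0 t ω
    simp only [hG]
    positivity
  have hGdep : ∀ t k, DependsOn (G t k) (F (t + k + 1) : Set I) := fun t k ω η hω => by
    simp only [hG, hx.dep (t + k + 1) hω, hx.dep_of_le (Nat.le_succ (t + k)) hω,
      hx.dep_of_le (show t ≤ t + k + 1 by omega) hω]
  -- Divided by its value at time t, the martingale falls from 1 to 0 on S, so the relative errors
  -- after any time t add up to at least 1.
  have hsub : ∀ t, S ⊆ {ω | 1 ≤ ∑' k, ENNReal.ofReal (G t k ω)} := by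
    rintro t ω ⟨h1, hlim⟩
    have hX : 1 ≤ x t ω ⬝ᵥ 1 :=
      h1.trans (monotone_nat_of_le_succ (f := fun t => x t ω ⬝ᵥ 1)
        (fun t => hx.total_mono t ω) (Nat.zero_le t))
    have hZ : 0 < x t ω ⬝ᵥ r := (hab _ (hx.nonneg t ω)).1.trans_lt' (by positivity)
    have hpart : ∀ n, 1 - (x t ω ⬝ᵥ r)⁻¹ * (x (t + n) ω ⬝ᵥ r) / ρ ^ n ≤
        ∑ k ∈ Finset.range n, G t k ω := by
      intro n
      induction n with
      | zero => simp [hZ.ne']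
      | succ n ih =>
        rw [Finset.sum_range_succ]
        have h2 : (x t ω ⬝ᵥ r)⁻¹ * (x (t + n) ω ⬝ᵥ r) / ρ ^ n -
            (x t ω ⬝ᵥ r)⁻¹ * (x (t + (n + 1)) ω ⬝ᵥ r) / ρ ^ (n + 1) =
            -((x t ω ⬝ᵥ r)⁻¹ * (x (t + n + 1) ω ⬝ᵥ r - x (t + n) ω ⬝ᵥ (N *ᵥ r)) / ρ ^ n) / ρ := by
          rw [h, dotProduct_smul, smul_eq_mul, pow_succ, ← add_assoc]
          field_simp
          ring
        have h3 : -((x t ω ⬝ᵥ r)⁻¹ * (x (t + n + 1) ω ⬝ᵥ r - x (t + n) ω ⬝ᵥ (N *ᵥ r)) / ρ ^ n) / ρ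
            ≤ G t n ω := by
          rw [div_le_iff₀ hρ0]
          have h4 : -((x t ω ⬝ᵥ r)⁻¹ * (x (t + n + 1) ω ⬝ᵥ r - x (t + n) ω ⬝ᵥ (N *ᵥ r)) / ρ ^ n)
              ≤ G t n ω := by
            refine (neg_le_abs _).trans (le_of_eq ?_)
            rw [abs_div, abs_mul, abs_of_pos (inv_pos.2 hZ), abs_of_pos (pow_pos hρ0 n)]
          exact h4.trans (le_mul_of_one_le_right (hG0 t n ω) hρ.le)
        linarith
    have hpart2 : ∀ n, ENNReal.ofReal (1 - (x t ω ⬝ᵥ r)⁻¹ * (x (t + n) ω ⬝ᵥ r) / ρ ^ n) ≤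
        ∑' k, ENNReal.ofReal (G t k ω) := by
      intro n
      refine (ENNReal.ofReal_le_ofReal (hpart n)).trans ?_
      rw [ENNReal.ofReal_sum_of_nonneg fun k _ => hG0 t k ω]
      exact ENNReal.sum_le_tsum _
    have hl : Tendsto (fun n => 1 - (x t ω ⬝ᵥ r)⁻¹ * (x (t + n) ω ⬝ᵥ r) / ρ ^ n) atTop
        (𝓝 1) := by
      have h5 := (((tendsto_add_atTop_iff_nat t).2 hlim).const_mul
        ((x t ω ⬝ᵥ r)⁻¹ * ρ ^ t)).const_sub 1
      rw [mul_zero, sub_zero] at h5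
      refine h5.congr fun n => ?_
      rw [add_comm n t, pow_add]
      field_simp
    have := le_of_tendsto' (ENNReal.tendsto_ofReal hl) hpart2
    simpa using this
  have hmeas : ∀ c : ℝ, 0 < c → ∀ t, μ S ≤ ENNReal.ofReal ((1 - (√ρ)⁻¹)⁻¹ *
      (c + C * (∫ ω, (x t ω ⬝ᵥ r)⁻¹ ∂μ) / c)) := by
    intro c hc t
    have hm : Measurable fun ω => ∑' k, ENNReal.ofReal (G t k ω) :=
      Measurable.tsum fun k => (hGdep t k).measurable_of_finite.ennreal_ofReal
    -- Markov's inequality; S itself need not be shown measurable.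
    have h1 := mul_meas_ge_le_lintegral₀ (μ := μ) hm.aemeasurable 1
    rw [one_mul] at h1
    refine (measure_mono (hsub t)).trans (h1.trans ?_)
    refine lintegral_tsum_ofReal_le_of_geometric (hG0 t)
      (fun k => (hGdep t k).integrable_of_finite μ) (inv_nonneg.2 (Real.sqrt_nonneg ρ))
      (inv_lt_one_of_one_lt₀ hσ) fun k => ?_
    have h2 := hbd t (fun ω => (x t ω ⬝ᵥ r)⁻¹) (fun ω η hω => by simp only [hx.dep t hω])
      (fun ω => inv_nonneg.2 (hZ0 t ω)) c hc k
    have h3 : ∀ ω, (x t ω ⬝ᵥ r)⁻¹ ^ 2 * (x t ω ⬝ᵥ r) = (x t ω ⬝ᵥ r)⁻¹ := by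
      intro ω
      rcases eq_or_ne (x t ω ⬝ᵥ r) 0 with h0 | h0
      · simp [h0]
      · field_simp
    simp only [h3] at h2
    exact h2
  -- With c fixed, t → ∞ removes the term with the mean inverse; afterwards c → 0.
  have hmeas2 : ∀ c : ℝ, 0 < c → μ S ≤ ENNReal.ofReal ((1 - (√ρ)⁻¹)⁻¹ * c) := by
    intro c hc
    have hl := ((((hx.tendsto_integral_inv hρ hr h).const_mul C).div_const c).const_add c).const_mul
      (1 - (√ρ)⁻¹)⁻¹
    simp only [mul_zero, zero_div, add_zero] at hl
    exact ge_of_tendsto' (ENNReal.tendsto_ofReal hl) (hmeas c hc)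
  have hzero : μ S = 0 := by
    refine le_antisymm ?_ zero_le
    have hl : Tendsto (fun c : ℝ => ENNReal.ofReal ((1 - (√ρ)⁻¹)⁻¹ * c)) (𝓝[>] 0) (𝓝 0) := by
      have : Tendsto (fun c : ℝ => (1 - (√ρ)⁻¹)⁻¹ * c) (𝓝[>] 0) (𝓝 0) := by
        have h1 : Tendsto (fun c : ℝ => (1 - (√ρ)⁻¹)⁻¹ * c) (𝓝 0) (𝓝 ((1 - (√ρ)⁻¹)⁻¹ * 0)) :=
          (continuous_const.mul continuous_id).tendsto 0
        rw [mul_zero] at h1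
        exact h1.mono_left nhdsWithin_le_nhds
      simpa using ENNReal.tendsto_ofReal this
    refine ge_of_tendsto hl ?_
    filter_upwards [self_mem_nhdsWithin] with c hc using hmeas2 c hc
  rw [ae_iff]
  convert hzero using 2
  ext ω
  simp [hS]

/-- The total of the process is almost surely asymptotic to a positive multiple of `ρ ^ t`. -/
theorem ae_exists_tendsto [DecidableEq Y] (hx : IsMeanGrowth μ F N x) (hN : N.IsPrimitive)
    (hrow : ∀ y, 1 ≤ ∑ z, N y z) :
    ∀ᵐ ω ∂μ, 1 ≤ x 0 ω ⬝ᵥ 1 → ∃ c : ℝ, 0 < c ∧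
      Tendsto (fun t => x t ω ⬝ᵥ 1 / specRadius N ^ t) atTop (𝓝 c) := by
  obtain ⟨ρ, r, hρ0, hr, h⟩ := hN.exists_pos_eigenvector
  rw [specRadius_eq_of_pos_eigenvector hN.nonneg hρ0 hr h]
  rcases (one_le_of_pos_eigenvector hN.nonneg hrow hr h).lt_or_eq with hρ | rfl
  · obtain ⟨β, hβ, hlim⟩ := hN.exists_tendsto_pow_mulVec hρ0 hr h (f := 1) fun _ => one_pos
    filter_upwards [hx.ae_not_tendsto_zero hρ hr h, hx.ae_summable hρ hr h r,
      ae_all_iff.2 fun k : ℕ => hx.ae_summable hρ hr h ((N ^ k) *ᵥ 1)] with ω h1 h2 h3 h4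
    -- Consecutive differences of x t ⬝ᵥ r / ρ ^ t are the summable errors, up to the factor ρ⁻¹.
    have hW : ∃ w, Tendsto (fun t => x t ω ⬝ᵥ r / ρ ^ t) atTop (𝓝 w) := by
      refine cauchySeq_tendsto_of_complete (cauchySeq_of_summable_dist ?_)
      refine (h2.mul_left ρ⁻¹).congr fun t => ?_
      rw [dist_comm, Real.dist_eq, h, dotProduct_smul, smul_eq_mul,
        ← abs_of_pos (pow_pos hρ0 t), ← abs_div, abs_of_pos (pow_pos hρ0 t),
        ← abs_of_pos (inv_pos.2 hρ0), ← abs_mul]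
      congr 1
      rw [pow_succ]
      field_simp
    obtain ⟨w, hw⟩ := hW
    have hw0 : 0 ≤ w := ge_of_tendsto' hw fun t =>
      div_nonneg (Finset.sum_nonneg fun y _ => mul_nonneg (hx.nonneg t ω y) (hr y).le)
        (pow_pos hρ0 t).le
    have hwpos : 0 < w := lt_of_le_of_ne hw0 fun h0 => h1 h4 (h0 ▸ hw)
    refine ⟨β * w, mul_pos hβ hwpos, tendsto_dotProduct_div_pow hρ0 hr hlim
      (fun t => hx.nonneg t ω) (fun k => ?_) hw⟩
    rw [tendsto_zero_iff_abs_tendsto_zero]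
    refine (h3 k).tendsto_atTop_zero.congr fun t => ?_
    simp only [Function.comp_def]
    rw [abs_div, abs_of_pos (pow_pos hρ0 t)]
  -- Critical case ρ = 1: a constant eigenvector means N 1 = 1.
  · rw [one_smul] at h
    obtain ⟨c, hc⟩ := hN.eigenvector_const hrow hr h
    have hc0 : c ≠ 0 := fun h0 => (hr (Classical.arbitrary Y)).ne' ((hc _).trans h0)
    have hone : N *ᵥ (1 : Y → ℝ) = 1 := by
      have hrc : r = c • (1 : Y → ℝ) := by ext y; simp [hc y]
      rw [hrc, Matrix.mulVec_smul] at h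
      exact smul_right_injective _ hc0 h
    filter_upwards [hx.ae_total_eq hone] with ω hω h4
    refine ⟨x 0 ω ⬝ᵥ 1, zero_lt_one.trans_le h4, ?_⟩
    simp [hω]

end IsMeanGrowth

end MeanGrowth

/-! ### Degrees as sums over arc ends -/

noncomputable section Substitution

open scoped Matrix

open Classical in
/-- The sum of those of the weights `α`, `β` of the ends `x`, `y` of an arc that lie at `v`. -/
def endSum {V : Type*} (v x y : V) (α β : ℝ) : ℝ :=
  (if x = v then α else 0) + (if y = v then β else 0)

section endSum

variable {V : Type*} (v x y : V)

theorem endSum_mono {α β α' β' : ℝ} (hα : α ≤ α') (hβ : β ≤ β') :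
    endSum v x y α β ≤ endSum v x y α' β' := by
  unfold endSum
  split_ifs <;> linarith

theorem endSum_sub (α β α' β' : ℝ) :
    endSum v x y α β - endSum v x y α' β' = endSum v x y (α - α') (β - β') := by
  unfold endSum
  split_ifs <;> ring

theorem endSum_const (c : ℝ) : endSum v x y c c = c * endSum v x y 1 1 := by
  unfold endSum
  split_ifs <;> ring

/-- The factor 2 is due to loops at v, where (α + β)² ≤ 4 c² = 2 c² · 2. -/
theorem endSum_sq_le {α β c : ℝ} (hα : |α| ≤ c) (hβ : |β| ≤ c) :
    endSum v x y α β ^ 2 ≤ 2 * c ^ 2 * endSum v x y 1 1 := by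
  obtain ⟨h1, h2⟩ := abs_le.1 hα
  obtain ⟨h3, h4⟩ := abs_le.1 hβ
  unfold endSum
  split_ifs <;> nlinarith [sq_nonneg (α - β)]

theorem sum_mul_endSum {ι : Type*} (s : Finset ι) (p α β : ι → ℝ) :
    ∑ k ∈ s, p k * endSum v x y (α k) (β k) =
      endSum v x y (∑ k ∈ s, p k * α k) (∑ k ∈ s, p k * β k) := by
  unfold endSum
  split_ifs <;> simp [mul_add, Finset.sum_add_distrib]

end endSum

namespace Network

variable {C V E : Type*}

/-- The vector of the coloured out-degrees (second index `0`) and in-degrees (second index `1`). -/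
def degVec (G : Network C V E) (v : V) : C × Fin 2 → ℝ := fun y =>
  ((if y.2 = 0 then G.outDeg y.1 v else G.inDeg y.1 v : ℕ) : ℝ)

/-- Regroups the colour counts arc by arc, the form on which substitution acts. -/
theorem degVec_dotProduct [Fintype C] (G : Network C V E) (v : V) (f : C × Fin 2 → ℝ) :
    G.degVec v ⬝ᵥ f =
      ∑ e ∈ G.arcs, endSum v (G.src e) (G.tgt e) (f (G.color e, 0)) (f (G.color e, 1)) := by
  classical
  have h1 : ∀ (P : E → V) (b : Fin 2),
      ∑ j, ((G.arcs.filter fun e => G.color e = j ∧ P e = v).card : ℝ) * f (j, b) =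
        ∑ e ∈ G.arcs, if P e = v then f (G.color e, b) else 0 := by
    intro P b
    simp only [Finset.card_filter, Nat.cast_sum, Finset.sum_mul]
    rw [Finset.sum_comm]
    refine Finset.sum_congr rfl fun e _ => ?_
    by_cases h : P e = v <;> simp [h]
  simp only [dotProduct, Fintype.sum_prod_type, Fin.sum_univ_two, degVec, Finset.sum_add_distrib,
    endSum]
  simp only [if_true, one_ne_zero, if_false]
  rw [← h1 G.src 0, ← h1 G.tgt 1]
  unfold outDeg inDeg
  congr 1

theorem degVec_dotProduct_one [Fintype C] (G : Network C V E) (v : V) :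
    G.degVec v ⬝ᵥ 1 = G.deg v := by
  classical
  rw [degVec_dotProduct]
  simp only [endSum, Pi.one_apply, Finset.sum_add_distrib, deg, Finset.card_filter, Nat.cast_add,
    Nat.cast_sum, Nat.cast_ite, Nat.cast_one, Nat.cast_zero]

theorem deg_pos_iff (G : Network C V E) (v : V) :
    0 < G.deg v ↔ ∃ e ∈ G.arcs, G.src e = v ∨ G.tgt e = v := by
  classical
  unfold deg
  rw [add_pos_iff, Finset.card_pos, Finset.card_pos, Finset.filter_nonempty_iff,
    Finset.filter_nonempty_iff]
  simp only [and_or_left, exists_or]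

end Network

/-! ### Genealogy of arcs and nodes, and the one-step growth of degrees -/

namespace SubstSystem

variable {l : ℕ} {V₀ E₀ V E : Type*} (S : SubstSystem l V₀ E₀ V E)

/-- The step at which an arc can arise. -/
def gen {S : SubstSystem l V₀ E₀ V E} : Arc S → ℕ
  | .init _ => 0
  | .sub a _ _ _ => gen a + 1

/-- The step at which a node can arise. -/
def birth {S : SubstSystem l V₀ E₀ V E} : Node S → ℕ
  | .init _ => 0
  | .new a _ _ _ => gen a + 1

open Classical in
/-- The arcs that can arise at step `t`. -/
def possibleArcs : ℕ → Finset (Arc S)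
  | 0 => S.init.arcs.image .init
  | t + 1 => (possibleArcs t).biUnion fun a => Finset.univ.biUnion fun k =>
      (S.rule (S.color a) k).arcs.image (.sub a (S.color a) k)

open Classical in
/-- The nodes that can arise up to step `t`. -/
def possibleNodes : ℕ → Finset (Node S)
  | 0 => S.init.nodes.image .init
  | t + 1 => possibleNodes t ∪ (S.possibleArcs t).biUnion fun a => Finset.univ.biUnion fun k =>
      (S.rule (S.color a) k).nodes.image (.new a (S.color a) k)

open Classical in
/-- The arcs that can arise before step `t`. -/
def past (t : ℕ) : Finset (Arc S) := (Finset.range t).biUnion S.possibleArcs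

theorem past_mono : Monotone S.past := fun _ _ h => by
  classical exact Finset.biUnion_subset_biUnion_of_subset_left _ (Finset.range_mono h)

theorem possibleArcs_subset_past (t : ℕ) : S.possibleArcs t ⊆ S.past (t + 1) := by
  classical exact Finset.subset_biUnion_of_mem _ (Finset.self_mem_range_succ t)

theorem gen_of_mem_possibleArcs {t : ℕ} {a : Arc S} (ha : a ∈ S.possibleArcs t) : gen a = t := by
  induction t generalizing a with
  | zero =>
    simp only [possibleArcs, Finset.mem_image] at ha
    obtain ⟨e, -, rfl⟩ := ha
    rfl
  | succ t ih =>
    simp only [possibleArcs, Finset.mem_biUnion, Finset.mem_image] at ha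
    obtain ⟨b, hb, k, -, r, -, rfl⟩ := ha
    simp [gen, ih hb]

/-- The name of an arc records its generation. Hence the choices made at step t are independent of
those that determine G^t. -/
theorem disjoint_past_possibleArcs (t : ℕ) : Disjoint (S.past t) (S.possibleArcs t) := by
  classical
  rw [Finset.disjoint_left]
  intro a ha hat
  obtain ⟨u, hu, hau⟩ := Finset.mem_biUnion.1 ha
  have := S.gen_of_mem_possibleArcs hat
  have := S.gen_of_mem_possibleArcs hau
  have := Finset.mem_range.1 hu
  omega

theorem arcs_subset_possibleArcs (ω : S.Realisation) (t : ℕ) :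
    S.arcs ω t ⊆ S.possibleArcs t := by
  induction t with
  | zero => exact subset_rfl
  | succ t ih =>
    intro b hb
    simp only [arcs, Finset.mem_biUnion, Finset.mem_image] at hb
    obtain ⟨a, ha, r, hr, rfl⟩ := hb
    simp only [possibleArcs, Finset.mem_biUnion, Finset.mem_image]
    exact ⟨a, ih ha, ω a, Finset.mem_univ _, r, hr, rfl⟩

theorem nodes_subset_possibleNodes (ω : S.Realisation) (t : ℕ) :
    S.nodes ω t ⊆ S.possibleNodes t := by
  induction t with
  | zero => exact subset_rfl
  | succ t ih =>
    intro v hv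
    simp only [nodes, Finset.mem_union, Finset.mem_biUnion, Finset.mem_image,
      Finset.mem_sdiff] at hv
    simp only [possibleNodes, Finset.mem_union, Finset.mem_biUnion, Finset.mem_image]
    rcases hv with hv | ⟨a, ha, w, ⟨hw, -⟩, rfl⟩
    · exact Or.inl (ih hv)
    · exact Or.inr ⟨a, S.arcs_subset_possibleArcs ω t ha, ω a, Finset.mem_univ _, w, hw, rfl⟩

theorem birth_le_of_mem_possibleNodes {t : ℕ} {v : Node S} (hv : v ∈ S.possibleNodes t) :
    birth v ≤ t := by
  induction t with
  | zero =>
    simp only [possibleNodes, Finset.mem_image] at hv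
    obtain ⟨w, -, rfl⟩ := hv
    exact le_rfl
  | succ t ih =>
    simp only [possibleNodes, Finset.mem_union, Finset.mem_biUnion, Finset.mem_image] at hv
    rcases hv with hv | ⟨a, ha, k, -, w, -, rfl⟩
    · exact (ih hv).trans t.le_succ
    · simp [birth, S.gen_of_mem_possibleArcs ha]

theorem dependsOn_arcs (t : ℕ) :
    DependsOn (fun ω : S.Realisation => S.arcs ω t) (S.past t : Set (Arc S)) := by
  classical
  induction t with
  | zero => exact fun _ _ _ => rfl
  | succ t ih =>
    intro ω η h
    have h1 : S.arcs ω t = S.arcs η t :=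
      ih fun i hi => h i (Finset.coe_subset.2 (S.past_mono t.le_succ) hi)
    simp only [arcs]
    rw [h1]
    refine Finset.biUnion_congr rfl fun a ha => ?_
    rw [h a (S.possibleArcs_subset_past t (S.arcs_subset_possibleArcs η t ha))]

/-- A node created by replacing a is born after the generation of a, so an older v can only be the
image of A or B. -/
theorem place_eq_iff {a : Arc S} {x y v : Node S} {i : Fin l} {k : Fin (S.q i)} {w : V}
    (hv : birth v ≤ gen a) :
    S.place a x y i k w = v ↔ (w = S.A ∧ x = v) ∨ (w = S.B ∧ y = v) := by
  have hBA := S.A_ne_B.symm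
  have hne : Node.new a i k w ≠ v := by
    rintro rfl
    simp [birth] at hv
  unfold place
  split_ifs with h1 h2
  · subst h1; simp [S.A_ne_B]
  · subst h2; simp [hBA]
  · simp [h1, h2, hne]

/-- An arc end of the copy lies at v through A at x or through B at y; if a is a loop at v, both
routes count. -/
theorem endSum_place {a : Arc S} {x y v : Node S} {i : Fin l} {k : Fin (S.q i)} {w w' : V}
    (hv : birth v ≤ gen a) (α β : ℝ) :
    endSum v (S.place a x y i k w) (S.place a x y i k w') α β =
      endSum v x y (endSum S.A w w' α β) (endSum S.B w w' α β) := by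
  classical
  have key : ∀ (z : V) (γ : ℝ), (if S.place a x y i k z = v then γ else 0) =
      (if x = v then (if z = S.A then γ else 0) else 0) +
        (if y = v then (if z = S.B then γ else 0) else 0) := by
    intro z γ
    have hBA := S.A_ne_B.symm
    rw [if_congr (S.place_eq_iff (w := z) hv) rfl rfl]
    rcases eq_or_ne z S.A with h | h
    · simp [h, S.A_ne_B]
    · simp only [h, false_and, false_or, if_false, ite_self, zero_add]
      split_ifs <;> simp_all
  have h1 := key w α
  have h2 := key w' β
  unfold endSum
  split_ifs at * <;> linarith

/-- How the degrees of an existing node change in one step. -/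
theorem degVec_succ_dotProduct (ω : S.Realisation) {t : ℕ} {v : Node S} (hv : birth v ≤ t)
    (f : Fin l × Fin 2 → ℝ) :
    (S.graph ω (t + 1)).degVec v ⬝ᵥ f = ∑ a ∈ S.arcs ω t, endSum v (S.ends a).1 (S.ends a).2
      ((S.rule (S.color a) (ω a)).degVec S.A ⬝ᵥ f) ((S.rule (S.color a) (ω a)).degVec S.B ⬝ᵥ f) := by
  classical
  rw [Network.degVec_dotProduct]
  change ∑ b ∈ S.arcs ω (t + 1), endSum v (S.ends b).1 (S.ends b).2 (f (S.color b, 0))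
    (f (S.color b, 1)) = _
  rw [arcs, Finset.sum_biUnion]
  · refine Finset.sum_congr rfl fun a ha => ?_
    have hga : birth v ≤ gen a := by
      rwa [S.gen_of_mem_possibleArcs (S.arcs_subset_possibleArcs ω t ha)]
    rw [Finset.sum_image fun r _ r' _ h => by simpa using h]
    simp only [ends, S.endSum_place hga, Network.degVec_dotProduct]
    have := sum_mul_endSum v (S.ends a).1 (S.ends a).2 (S.rule (S.color a) (ω a)).arcs (fun _ => 1)
    simp only [one_mul] at this
    rw [this]
    rfl
  -- Copies replacing different arcs share no arc, as the parent is part of the name.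
  · intro a _ b _ hab
    simp only [Function.onFun, Finset.disjoint_left, Finset.mem_image]
    rintro _ ⟨r, _, rfl⟩ ⟨r', _, h⟩
    simp only [Arc.sub.injEq] at h
    exact hab h.1.symm

theorem meanDegMatrix_mulVec (f : Fin l × Fin 2 → ℝ) (z : Fin l × Fin 2) :
    (S.meanDegMatrix *ᵥ f) z = ∑ k, (S.p z.1 k).toReal *
      ((S.rule z.1 k).degVec (if z.2 = 0 then S.A else S.B) ⬝ᵥ f) := by
  simp only [Matrix.mulVec, dotProduct, meanDegMatrix, Finset.sum_mul, Finset.mul_sum]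
  rw [Finset.sum_comm]
  refine Finset.sum_congr rfl fun k _ => Finset.sum_congr rfl fun y _ => ?_
  rw [mul_assoc]
  rfl

theorem sum_toReal_eq_one {n : ℕ} (p : PMF (Fin n)) : ∑ k, (p k).toReal = 1 := by
  have := p.integral_eq_sum fun _ => (1 : ℝ)
  simpa using this.symm

/-- A row sum is the mean degree of A or B in a random rule, and these nodes are never isolated.
This is what excludes ρ < 1. -/
theorem one_le_sum_meanDegMatrix
    (hrule : ∀ (i : Fin l) (k : Fin (S.q i)), ∀ v ∈ (S.rule i k).nodes, 0 < (S.rule i k).deg v)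
    (z : Fin l × Fin 2) : 1 ≤ ∑ y, S.meanDegMatrix z y := by
  have h1 : ∑ y, S.meanDegMatrix z y = (S.meanDegMatrix *ᵥ 1) z := by
    simp [Matrix.mulVec, dotProduct]
  rw [h1, meanDegMatrix_mulVec, ← sum_toReal_eq_one (S.p z.1)]
  refine Finset.sum_le_sum fun k _ => le_mul_of_one_le_right ENNReal.toReal_nonneg ?_
  rw [Network.degVec_dotProduct_one]
  refine Nat.one_le_cast.2 (hrule _ _ _ ?_)
  split_ifs
  exacts [S.A_mem _ _, S.B_mem _ _]

/-- Each arc end at v becomes at least one arc end at v, because A and B are not isolated. -/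
theorem degVec_dotProduct_one_mono
    (hrule : ∀ (i : Fin l) (k : Fin (S.q i)), ∀ v ∈ (S.rule i k).nodes, 0 < (S.rule i k).deg v)
    (ω : S.Realisation) {t : ℕ} {v : Node S} (hv : birth v ≤ t) :
    (S.graph ω t).degVec v ⬝ᵥ 1 ≤ (S.graph ω (t + 1)).degVec v ⬝ᵥ 1 := by
  rw [S.degVec_succ_dotProduct ω hv, Network.degVec_dotProduct]
  refine Finset.sum_le_sum fun a _ => endSum_mono _ _ _ ?_ ?_
  · rw [Network.degVec_dotProduct_one]
    exact Nat.one_le_cast.2 (hrule _ _ _ (S.A_mem _ _))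
  · rw [Network.degVec_dotProduct_one]
    exact Nat.one_le_cast.2 (hrule _ _ _ (S.B_mem _ _))

/-- A fresh node inherits an incident arc from its rule, and an old one never loses degree. -/
theorem deg_pos
    (hinit : ∀ v ∈ S.init.nodes, 0 < S.init.deg v)
    (hrule : ∀ (i : Fin l) (k : Fin (S.q i)), ∀ v ∈ (S.rule i k).nodes, 0 < (S.rule i k).deg v)
    (ω : S.Realisation) {t : ℕ} {v : Node S} (hv : v ∈ S.nodes ω t) :
    0 < (S.graph ω t).deg v := by
  classical
  induction t with
  | zero =>
    simp only [nodes, Finset.mem_image] at hv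
    obtain ⟨w, hw, rfl⟩ := hv
    obtain ⟨e, he, h⟩ := (S.init.deg_pos_iff w).1 (hinit w hw)
    refine (Network.deg_pos_iff _ _).2 ⟨.init e, Finset.mem_image_of_mem _ he, ?_⟩
    rcases h with h | h
    · exact Or.inl (congrArg Node.init h)
    · exact Or.inr (congrArg Node.init h)
  | succ t ih =>
    simp only [nodes, Finset.mem_union, Finset.mem_biUnion, Finset.mem_image,
      Finset.mem_sdiff, Finset.mem_insert, Finset.mem_singleton, not_or] at hv
    rcases hv with hv | ⟨a, ha, w, ⟨hw, hwA, hwB⟩, rfl⟩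
    · have h1 := S.degVec_dotProduct_one_mono hrule ω
        (S.birth_le_of_mem_possibleNodes (S.nodes_subset_possibleNodes ω t hv))
      rw [Network.degVec_dotProduct_one, Network.degVec_dotProduct_one, Nat.cast_le] at h1
      exact (ih hv).trans_le h1
    · obtain ⟨r, hr, h⟩ := (Network.deg_pos_iff _ w).1 (hrule _ _ w hw)
      refine (Network.deg_pos_iff _ _).2 ⟨.sub a (S.color a) (ω a) r,
        Finset.mem_biUnion.2 ⟨a, ha, Finset.mem_image_of_mem _ hr⟩, ?_⟩
      have hp : S.place a (S.ends a).1 (S.ends a).2 (S.color a) (ω a) w =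
          .new a (S.color a) (ω a) w := by
        simp [place, hwA, hwB]
      rcases h with h | h
      · left
        rw [← hp]
        change S.place _ _ _ _ _ _ = _
        rw [h]
      · right
        rw [← hp]
        change S.place _ _ _ _ _ _ = _
        rw [h]

/-- The deviation of the contribution of the arc `a` to the next degrees of `v` from its mean. -/
def deviation (v : Node S) (f : Fin l × Fin 2 → ℝ) (a : Arc S) (k : Fin (S.q (S.color a))) : ℝ :=
  endSum v (S.ends a).1 (S.ends a).2
    ((S.rule (S.color a) k).degVec S.A ⬝ᵥ f - (S.meanDegMatrix *ᵥ f) (S.color a, 0))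
    ((S.rule (S.color a) k).degVec S.B ⬝ᵥ f - (S.meanDegMatrix *ᵥ f) (S.color a, 1))

theorem integral_deviation (v : Node S) (f : Fin l × Fin 2 → ℝ) (a : Arc S) :
    ∫ k, S.deviation v f a k ∂(S.p (S.color a)).toMeasure = 0 := by
  rw [PMF.integral_eq_sum]
  simp only [deviation, smul_eq_mul, sum_mul_endSum, mul_sub, Finset.sum_sub_distrib,
    ← Finset.sum_mul, sum_toReal_eq_one, one_mul, meanDegMatrix_mulVec]
  simp [endSum]

theorem degVec_succ_sub (ω : S.Realisation) {t : ℕ} {v : Node S} (hv : birth v ≤ t)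
    (f : Fin l × Fin 2 → ℝ) :
    (S.graph ω (t + 1)).degVec v ⬝ᵥ f - (S.graph ω t).degVec v ⬝ᵥ (S.meanDegMatrix *ᵥ f) =
      ∑ a ∈ S.arcs ω t, S.deviation v f a (ω a) := by
  rw [S.degVec_succ_dotProduct ω hv, Network.degVec_dotProduct]
  change _ - ∑ a ∈ S.arcs ω t, endSum v (S.ends a).1 (S.ends a).2 _ _ = _
  rw [← Finset.sum_sub_distrib]
  exact Finset.sum_congr rfl fun a _ => endSum_sub _ _ _ _ _ _ _

/-- There are finitely many rules, so one constant works. The factor kept on the right sums over the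
arcs to the degree of v, as the variance bound requires. -/
theorem exists_deviation_sq_le (v : Node S) (f : Fin l × Fin 2 → ℝ) :
    ∃ C : ℝ, 0 ≤ C ∧ ∀ a k, S.deviation v f a k ^ 2 ≤
      C * endSum v (S.ends a).1 (S.ends a).2 1 1 := by
  obtain ⟨c, hc⟩ := (Set.finite_range fun u : (Σ i : Fin l, Fin (S.q i)) × Fin 2 =>
    |(S.rule u.1.1 u.1.2).degVec (if u.2 = 0 then S.A else S.B) ⬝ᵥ f -
      (S.meanDegMatrix *ᵥ f) (u.1.1, u.2)|).bddAbove
  exact ⟨2 * c ^ 2, by positivity, fun a k => endSum_sq_le _ _ _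
    (hc ⟨(⟨S.color a, k⟩, 0), by simp⟩) (hc ⟨(⟨S.color a, k⟩, 1), by simp⟩)⟩

theorem exists_degVec_le : ∃ M : ℝ, 0 ≤ M ∧ ∀ i (k : Fin (S.q i)),
    (S.rule i k).degVec S.A ⬝ᵥ 1 ≤ M ∧ (S.rule i k).degVec S.B ⬝ᵥ 1 ≤ M := by
  obtain ⟨c, hc⟩ := (Set.finite_range fun u : (Σ i : Fin l, Fin (S.q i)) × Fin 2 =>
    (S.rule u.1.1 u.1.2).degVec (if u.2 = 0 then S.A else S.B) ⬝ᵥ 1).bddAbove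
  exact ⟨max c 0, le_max_right _ _, fun i k => ⟨le_max_of_le_left (hc ⟨(⟨i, k⟩, 0), by simp⟩),
    le_max_of_le_left (hc ⟨(⟨i, k⟩, 1), by simp⟩)⟩⟩

instance : IsProbabilityMeasure S.law := by
  unfold law
  infer_instance

theorem dependsOn_degVec (t : ℕ) (v : Node S) :
    DependsOn (fun ω : S.Realisation => (S.graph ω t).degVec v) (S.past t : Set (Arc S)) := by
  intro ω η h
  have h1 := S.dependsOn_arcs t h
  simp only at h1
  ext y
  simp only [Network.degVec, Network.outDeg, Network.inDeg, graph, h1]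
  rfl

/-- From its birth on, the degrees of a node form a process with mean growth matrix `N`. -/
theorem isMeanGrowth_degVec
    (hrule : ∀ (i : Fin l) (k : Fin (S.q i)), ∀ v ∈ (S.rule i k).nodes, 0 < (S.rule i k).deg v)
    {s : ℕ} {v : Node S} (hv : birth v ≤ s) :
    IsMeanGrowth S.law (fun t => S.past (s + t)) S.meanDegMatrix
      (fun t (ω : S.Realisation) => (S.graph ω (s + t)).degVec v) := by
  classical
  have hvt : ∀ t, birth v ≤ s + t := fun t => hv.trans (Nat.le_add_right s t)
  -- The random index set is replaced by the fixed set of possible arcs with an indicator, which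
  -- depends on past choices only.
  have hsum : ∀ (f : Fin l × Fin 2 → ℝ) (ω : S.Realisation) (t : ℕ),
      (S.graph ω (s + (t + 1))).degVec v ⬝ᵥ f -
        (S.graph ω (s + t)).degVec v ⬝ᵥ (S.meanDegMatrix *ᵥ f) =
      ∑ a ∈ S.possibleArcs (s + t),
        (if a ∈ S.arcs ω (s + t) then 1 else 0) * S.deviation v f a (ω a) := by
    intro f ω t
    rw [← add_assoc, S.degVec_succ_sub ω (hvt t)]
    simp only [ite_mul, one_mul, zero_mul]
    rw [← Finset.sum_filter, Finset.filter_mem_eq_inter,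
      Finset.inter_eq_right.2 (S.arcs_subset_possibleArcs ω (s + t))]
  have hdep : ∀ (t : ℕ) (a : Arc S), DependsOn
      (fun ω : S.Realisation => if a ∈ S.arcs ω (s + t) then (1 : ℝ) else 0)
      (S.past (s + t) : Set (Arc S)) := by
    intro t a ω η h
    have h1 := S.dependsOn_arcs (s + t) h
    simp only at h1
    simp only [h1]
  refine ⟨fun t u h => S.past_mono (Nat.add_le_add_left h s),
    fun t => S.dependsOn_degVec (s + t) v, fun t ω y => Nat.cast_nonneg _, fun t ω => ?_,
    fun t ω => S.degVec_dotProduct_one_mono hrule ω (hvt t), ?_, fun t f g hg => ?_, fun f => ?_⟩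
  · rw [Network.degVec_dotProduct_one]
    rcases Nat.eq_zero_or_pos ((S.graph ω (s + t)).deg v) with h | h
    · left; simp [h]
    · right; exact Nat.one_le_cast.2 h
  · obtain ⟨M, hM, hle⟩ := S.exists_degVec_le
    refine ⟨M, hM, fun t ω => ?_⟩
    rw [← add_assoc, S.degVec_succ_dotProduct ω (hvt t), Network.degVec_dotProduct, Finset.mul_sum]
    refine Finset.sum_le_sum fun a _ => ?_
    refine (endSum_mono _ _ _ (hle _ _).1 (hle _ _).2).trans (le_of_eq ?_)
    exact endSum_const _ _ _ _
  · simp only [hsum, Finset.mul_sum, ← mul_assoc]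
    refine integral_mul_sum_eq_zero (fun a => (S.p (S.color a)).toMeasure)
      (S.disjoint_past_possibleArcs (s + t))
      (fun a (ω : S.Realisation) => g ω * if a ∈ S.arcs ω (s + t) then 1 else 0)
      (fun a _ ω η h => ?_) (S.deviation v f) fun a _ => S.integral_deviation v f a
    have := hdep t a h
    simp only at this
    simp only [hg h, this]
  · obtain ⟨C, hC, hle⟩ := S.exists_deviation_sq_le v f
    refine ⟨C, hC, fun t g hg hg0 => ?_⟩
    simp only [hsum]
    have hsq := integral_mul_sq_sum (fun a => (S.p (S.color a)).toMeasure)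
      (S.disjoint_past_possibleArcs (s + t)) hg
      (fun a (ω : S.Realisation) => if a ∈ S.arcs ω (s + t) then 1 else 0)
      (fun a _ => hdep t a) (S.deviation v f) fun a _ => S.integral_deviation v f a
    refine hsq.le.trans ?_
    rw [← integral_const_mul]
    have hdev : ∀ η : S.Realisation, ∑ a ∈ S.possibleArcs (s + t),
        (if a ∈ S.arcs η (s + t) then (1 : ℝ) else 0) ^ 2 * S.deviation v f a (η a) ^ 2 =
        ∑ a ∈ S.arcs η (s + t), S.deviation v f a (η a) ^ 2 := by
      intro η
      simp only [ite_pow, one_pow, zero_pow two_ne_zero, ite_mul, one_mul, zero_mul]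
      rw [← Finset.sum_filter, Finset.filter_mem_eq_inter,
        Finset.inter_eq_right.2 (S.arcs_subset_possibleArcs η (s + t))]
    refine integral_mono (DependsOn.integrable_of_finite (F := S.past (s + t + 1))
      (fun ω η h => ?_) _) (DependsOn.integrable_of_finite (F := S.past (s + t))
      (fun ω η h => ?_) _) fun ω => ?_
    · have h' : ∀ a ∈ (S.past (s + t) : Set (Arc S)), ω a = η a := fun a ha =>
        h a (Finset.coe_subset.2 (S.past_mono (Nat.le_succ _)) ha)
      have h1 := S.dependsOn_arcs (s + t) h'
      simp only at h1
      simp only [hdev]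
      simp only [hg h', h1]
      congr 1
      refine Finset.sum_congr rfl fun a ha => ?_
      rw [h a (S.possibleArcs_subset_past _ (S.arcs_subset_possibleArcs η _ ha))]
    · have := S.dependsOn_degVec (s + t) v h
      simp only at this
      simp only [hg h, this]
    · simp only [hdev]
      rw [mul_left_comm, Network.degVec_dotProduct]
      refine mul_le_mul_of_nonneg_left ?_ (hg0 ω)
      rw [Finset.mul_sum]
      exact Finset.sum_le_sum fun a _ => hle a (ω a)

/-- The almost sure statement is proved for each of the finitely many possible nodes, conditionally
on its presence, and then quantified over them. -/
theorem ae_asympEquiv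
    (hinit : ∀ v ∈ S.init.nodes, 0 < S.init.deg v)
    (hrule : ∀ (i : Fin l) (k : Fin (S.q i)), ∀ v ∈ (S.rule i k).nodes, 0 < (S.rule i k).deg v)
    (hN : S.meanDegMatrix.IsPrimitive) (s : ℕ) :
    ∀ᵐ ω ∂S.law, ∀ v ∈ S.nodes ω s,
      AsympEquivUpToConst (fun t => ((S.graph ω t).deg v : ℝ))
        (fun t => specRadius S.meanDegMatrix ^ (t - s)) := by
  have h1 : ∀ v ∈ S.possibleNodes s, ∀ᵐ ω ∂S.law, v ∈ S.nodes ω s →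
      AsympEquivUpToConst (fun t => ((S.graph ω t).deg v : ℝ))
        (fun t => specRadius S.meanDegMatrix ^ (t - s)) := by
    intro v hv
    rcases isEmpty_or_nonempty (Fin l) with hl | hl
    -- Without colours there are no arcs, hence no node of positive degree; Perron theory needs a
    -- non-empty index set.
    · refine ae_of_all _ fun ω hω => ?_
      obtain ⟨a, -⟩ := (Network.deg_pos_iff _ _).1 (S.deg_pos hinit hrule ω hω)
      exact hl.elim (S.color a)
    · have h2 := (S.isMeanGrowth_degVec hrule
        (S.birth_le_of_mem_possibleNodes hv)).ae_exists_tendsto hN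
        (S.one_le_sum_meanDegMatrix hrule)
      filter_upwards [h2] with ω hω hmem
      simp only [Network.degVec_dotProduct_one] at hω
      obtain ⟨c, hc, hlim⟩ := hω (Nat.one_le_cast.2 (S.deg_pos hinit hrule ω hmem))
      -- The limit only sees t ≥ s, where the truncated difference t - s is exact.
      refine ⟨c, hc, (tendsto_add_atTop_iff_nat s).1 (hlim.congr fun t => ?_)⟩
      simp only [add_comm t s, Nat.add_sub_cancel_left]
  filter_upwards [(S.possibleNodes s).eventually_all.2 h1] with ω hω v hv
  exact hω v (S.nodes_subset_possibleNodes ω s hv) hv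

theorem newNodes_subset_nodes (ω : S.Realisation) (s : ℕ) : S.newNodes ω s ⊆ S.nodes ω s := by
  classical
  cases s with
  | zero => exact subset_rfl
  | succ s =>
    intro v hv
    exact (Finset.mem_sdiff.1 hv).1

theorem nodes_mono (ω : S.Realisation) : Monotone (S.nodes ω) :=
  monotone_nat_of_le_succ fun _ => by classical exact Finset.subset_union_left

end SubstSystem

/-! ### From asymptotics to two-sided bounds -/

/-- A positive sequence that is asymptotic to a constant multiple of a positive sequence is bounded
above and below by constant multiples of it. -/
theorem AsympEquivUpToConst.exists_bounds {f g : ℕ → ℝ} (h : AsympEquivUpToConst f g) {s : ℕ}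
    (hf : ∀ t, s ≤ t → 0 < f t) (hg : ∀ t, 0 < g t) :
    ∃ c : ℝ, 0 < c ∧ ∀ t, s ≤ t → c⁻¹ * g t ≤ f t ∧ f t ≤ c * g t := by
  obtain ⟨c, hc, hlim⟩ := h
  obtain ⟨M, hM⟩ := hlim.bddAbove_range
  have hinv := (((tendsto_add_atTop_iff_nat s).2 hlim).inv₀ hc.ne')
  obtain ⟨M', hM'⟩ := hinv.bddAbove_range
  -- M bounds the ratio and M' its inverse from above; the 1 makes positivity of the constant
  -- immediate.
  refine ⟨max 1 (max M M'), by positivity, fun t ht => ⟨?_, ?_⟩⟩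
  · have h1 : (f t / g t)⁻¹ ≤ max 1 (max M M') :=
      (hM' ⟨t - s, by simp [Nat.sub_add_cancel ht]⟩).trans
        ((le_max_right _ _).trans (le_max_right _ _))
    have h2 := inv_le_of_inv_le₀ (div_pos (hf t ht) (hg t)) h1
    exact (le_div_iff₀ (hg t)).1 h2
  · have h1 : f t / g t ≤ max 1 (max M M') :=
      (hM ⟨t, rfl⟩).trans ((le_max_left _ _).trans (le_max_right _ _))
    exact (div_le_iff₀ (hg t)).1 h1

theorem SubstSystem.specRadius_pos {l : ℕ} [Nonempty (Fin l)] {V₀ E₀ V E : Type*}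
    (S : SubstSystem l V₀ E₀ V E) (hN : S.meanDegMatrix.IsPrimitive) :
    0 < specRadius S.meanDegMatrix := by
  obtain ⟨ρ, r, hρ, hr, h⟩ := hN.exists_pos_eigenvector
  rwa [specRadius_eq_of_pos_eigenvector hN.nonneg hρ hr h]

end Substitution

theorem mainTheorem3 {l : ℕ} {V₀ E₀ V E : Type*} (S : SubstSystem l V₀ E₀ V E)
    (hinit : ∀ v ∈ S.init.nodes, 0 < S.init.deg v)
    (hrule : ∀ (i : Fin l) (k : Fin (S.q i)), ∀ v ∈ (S.rule i k).nodes, 0 < (S.rule i k).deg v)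
    (hN : S.meanDegMatrix.IsPrimitive) (s : ℕ) :
    (∀ᵐ ω ∂S.law, ∀ v ∈ S.newNodes ω s,
      AsympEquivUpToConst (fun t => ((S.graph ω t).deg v : ℝ))
        (fun t => specRadius S.meanDegMatrix ^ (t - s))) ∧
    (∀ᵐ ω ∂S.law, ∀ v ∈ S.newNodes ω s, ∃ c : ℝ, 0 < c ∧ ∀ t : ℕ, s ≤ t →
      c⁻¹ * specRadius S.meanDegMatrix ^ (t - s) ≤ ((S.graph ω t).deg v : ℝ) ∧
      ((S.graph ω t).deg v : ℝ) ≤ c * specRadius S.meanDegMatrix ^ (t - s)) := by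
  have h := S.ae_asympEquiv hinit hrule hN s
  refine ⟨h.mono fun ω hω v hv => hω v (S.newNodes_subset_nodes ω s hv),
    h.mono fun ω hω v hv => ?_⟩
  have hmem := S.newNodes_subset_nodes ω s hv
  have hpos : ∀ t, s ≤ t → 0 < (S.graph ω t).deg v := fun t ht =>
    S.deg_pos hinit hrule ω (S.nodes_mono ω ht hmem)
  obtain ⟨a, -⟩ := (Network.deg_pos_iff _ _).1 (hpos s le_rfl)
  have : Nonempty (Fin l) := ⟨S.color a⟩
  exact (hω v hmem).exists_bounds (fun t ht => Nat.cast_pos.2 (hpos t ht))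
    fun t => pow_pos (S.specRadius_pos hN) _
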